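/- **Setting.** Let $M$ be an $n$-dimensional $C^\infty$ manifold and $T\subset TM\setminus 0$ an open set of nonzero tangent vectors, closed under multiplication by positive scalars (for instance $T=TM\setminus0$). A *Finsler structure over $T$* is a $C^\infty$ function $L:T\to(0,\infty)$, positively homogeneous of degree one on the fibres, such that $g_{ij}=\frac12\dot\partial_i\dot\partial_jL^2$ is nondegenerate, where $\partial_i=\partial/\partial x^i$, $\dot\partial_i=\partial/\partial y^i$. Put $\gamma^i_{jk}=\frac12g^{ir}(\partial_jg_{kr}+\partial_kg_{jr}-\partial_rg_{jk})$, $G^i=\frac12\gamma^i_{jk}y^jy^k$ (canonical spray), $N^i_j=\dot\partial_jG^i$ (Barthel, or Cartan nonlinear, connection), $\delta_i=\partial_i-N^r_i\dot\partial_r$, $\Gamma^i_{jk}=\frac12g^{ir}(\delta_jg_{kr}+\delta_kg_{jr}-\delta_rg_{jk})$, $C_{ijk}=\frac12\dot\partial_kg_{ij}$, $y_i=g_{ij}y^j$, $h_{ij}=g_{ij}-\dot\partial_iL\,\dot\partial_jL$. Let $\sigma\in C^\infty(M)$, let $\beta=b_i(x)y^i$ be a $C^\infty$ one-form on $M$,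 and let $f$ be a $C^\infty$, positively homogeneous function of degree one on an open cone of $\mathbb R^2$ containing all values $(e^\sigma L,\beta)$ on $T$. Let $L$ and $\overline L=f(e^{\sigma}L,\beta)$ both be Finsler structures over $T$; barred objects belong to $\overline L$. Indices on $f$ denote partial derivatives with respect to $\widetilde L=e^\sigma L$ (index 1) and $\beta$ (index 2), evaluated at $(e^\sigma L,\beta)$. Put $$q=ff_2,\quad p=ff_1/L,\quad q_0=ff_{22},\quad p_0=f_2^2+q_0,\quad p_{-1}=\frac{ff_{12}}L+\frac{pf_2}f,\quad p_{02}=\frac{\partial p_0}{\partial\beta},$$ $$b^i=g^{ij}b_j,\quad b^2=b^ib_i,\quad m_i=b_i-\frac{\beta}{L^2}y_i,\quad m^2=g^{ij}m_im_j,\quad \varepsilon=\frac{f^2(e^\sigma p+m^2q_0)}{L^2},$$ $$s_0=\frac{e^{-\sigma}f^2q_0}{\varepsilon pL^2},\quad s_{-1}=\frac{p_{-1}f^2}{p\,\varepsilon L^2},\quad s_{-2}=\frac{p_{-1}(e^\sigma m^2pL^2-b^2f^2)}{\varepsilon p\beta L^2}$$ (where $\beta=0$, $s_{-2}$ denotes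 the continuous extension $-p_{-1}b^2q/(\varepsilon pL^2)$), and $$\sigma_i=\partial_i\sigma,\quad \sigma^i=g^{ij}\sigma_j,\quad \sigma_0=\sigma_iy^i,\quad \sigma_\beta=\sigma_rb^r,$$ $$b_{i|j}=\delta_jb_i-b_r\Gamma^r_{ij},\quad b_{0|j}=b_{i|j}y^i,\quad 2E_{ij}=b_{i|j}+b_{j|i},\quad 2F_{ij}=b_{i|j}-b_{j|i},$$ $$E_{i0}=E_{ik}y^k,\quad E_{00}=E_{jk}y^jy^k,\quad F_{i0}=F_{ik}y^k,\quad F^i_0=g^{ij}F_{jk}y^k,\quad F_{\beta0}=F_{r0}b^r,$$ $$2B_{ij}=e^\sigma p_{-1}h_{ij}+p_{02}m_im_j,\qquad Q_i=e^\sigma p_{-1}y_i+p_0b_i,$$ $$V_{ijk}=\tfrac{e^\sigma p_{-1}}2(h_{ij}m_k+h_{jk}m_i+h_{ki}m_j)+\tfrac{p_{02}}2m_im_jm_k.$$ **Theorem.** In every chart of the smooth structure of $M$, at every $(x,y)\in T$ over the chart with $p(x,y)\neq0$: (a) $\overline G^i=G^i+D^i$, where $$D^i=\frac{\sigma_0}{2p}\Big\{\big[2p-\beta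 p_{-1}-e^\sigma p^2L^2s_{-2}-ps_{-1}(2e^\sigma p\beta+e^\sigma p_{-1}L^2m^2)\big]y^i-2e^\sigma p^2\beta s_0b^i\Big\}$$ $$\qquad+\frac qpe^{-\sigma}F^i_0-\frac12L^2\sigma^i+\frac12\big(e^\sigma pE_{00}-2qF_{\beta0}+e^\sigma pL^2\sigma_\beta\big)(s_0b^i+s_{-1}y^i).$$ (b) $\overline N^i_j=N^i_j+D^i_j$, where $$D^i_j=\frac{e^{-\sigma}}pA^i_j-(s_0b^i+s_{-1}y^i)A_{rj}b^r-(qb_{0|j}+e^\sigma pL^2\sigma_j)(s_{-1}b^i+s_{-2}y^i),\qquad A^i_j=g^{li}A_{lj},$$ $$A_{ij}=E_{00}B_{ij}+F_{i0}Q_j+qF_{ij}+E_{j0}Q_i-2(e^\sigma p\,C_{sij}+V_{sij})D^s$$ $$\qquad+\tfrac12\sigma_0\big[2e^\sigma pg_{ij}+2e^\sigma p_{-1}m_jy_i-2\beta B_{ij}+e^\sigma p_{-1}(b_iy_j-b_jy_i)\big]$$ $$\qquad-\tfrac12\sigma_i(e^\sigma L^2p_{-1}m_j+2e^\sigma py_j)+\tfrac12\sigma_j(2e^\sigma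 py_i+e^\sigma L^2p_{-1}m_i).$$ -/

import Mathlib

open scoped Manifold ContDiff

noncomputable section

namespace BetaConformal

/-! ### Partial derivatives of functions of `(x, y)` in local coordinates -/

/-- Coordinate space, used both for positions `x` and for fibre coordinates `y`. -/
abbrev Coord (n : ℕ) := EuclideanSpace ℝ (Fin n)

variable {n : ℕ}

/-- `∂_i H`, the partial derivative with respect to `x^i`. -/
def dx (i : Fin n) (H : Coord n → Coord n → ℝ) (x y : Coord n) : ℝ :=
  fderiv ℝ (fun z => H z y) x (EuclideanSpace.single i 1)

/-- `∂̇_i H`, the partial derivative with respect to `y^i`. -/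
def dy (i : Fin n) (H : Coord n → Coord n → ℝ) (x y : Coord n) : ℝ :=
  fderiv ℝ (fun w => H x w) y (EuclideanSpace.single i 1)

/-! ### Local Finsler geometry of a fundamental function `L(x, y)` -/

/-- `g_ij = (1/2) ∂̇_i ∂̇_j L²`. -/
def metric (L : Coord n → Coord n → ℝ) (x y : Coord n) : Matrix (Fin n) (Fin n) ℝ :=
  Matrix.of fun i j => (1 / 2) * dy i (dy j fun x y => L x y ^ 2) x y

/-- The inverse matrix `g^ij`. -/
def metricInv (L : Coord n → Coord n → ℝ) (x y : Coord n) : Matrix (Fin n) (Fin n) ℝ :=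
  (metric L x y)⁻¹

/-- The Cartan tensor `C_ijk = (1/2) ∂̇_k g_ij`. -/
def cartan (L : Coord n → Coord n → ℝ) (i j k : Fin n) (x y : Coord n) : ℝ :=
  (1 / 2) * dy k (fun x y => metric L x y i j) x y

/-- `γ^i_jk = (1/2) g^ir (∂_j g_kr + ∂_k g_jr - ∂_r g_jk)`. -/
def christoffel (L : Coord n → Coord n → ℝ) (i j k : Fin n) (x y : Coord n) : ℝ :=
  ∑ r, (1 / 2) * metricInv L x y i r *
    (dx j (fun x y => metric L x y k r) x y + dx k (fun x y => metric L x y j r) x y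
      - dx r (fun x y => metric L x y j k) x y)

/-- The canonical spray `G^i = (1/2) γ^i_jk y^j y^k`. -/
def spray (L : Coord n → Coord n → ℝ) (i : Fin n) (x y : Coord n) : ℝ :=
  (1 / 2) * ∑ j, ∑ k, christoffel L i j k x y * y j * y k

/-- The Barthel (Cartan nonlinear) connection `N^i_j = ∂̇_j G^i`. -/
def barthel (L : Coord n → Coord n → ℝ) (i j : Fin n) (x y : Coord n) : ℝ :=
  dy j (spray L i) x y

/-- The horizontal derivative `δ_k H = ∂_k H - N^r_k ∂̇_r H`. -/
def hder (L : Coord n → Coord n → ℝ) (k : Fin n) (H : Coord n → Coord n → ℝ)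
    (x y : Coord n) : ℝ :=
  dx k H x y - ∑ r, barthel L r k x y * dy r H x y

/-- The horizontal coefficients of the Cartan connection,
`Γ^i_jk = (1/2) g^ir (δ_j g_kr + δ_k g_jr - δ_r g_jk)`. -/
def cartanGamma (L : Coord n → Coord n → ℝ) (i j k : Fin n) (x y : Coord n) : ℝ :=
  ∑ r, (1 / 2) * metricInv L x y i r *
    (hder L j (fun x y => metric L x y k r) x y + hder L k (fun x y => metric L x y j r) x y
      - hder L r (fun x y => metric L x y j k) x y)

/-! ### Finsler structures on a manifold -/

section Manifold

variable {M : Type*} [TopologicalSpace M] [ChartedSpace (Coord n) M]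

/-- The tangent vector `y^i ∂/∂x^i` at the point with coordinates `x` in the chart `e`. -/
def coordVec (e : OpenPartialHomeomorph M (Coord n)) (x y : Coord n) :
    Bundle.TotalSpace (Coord n) (TangentSpace (𝓡 n) : M → Type _) :=
  ⟨e.symm x, mfderiv (𝓡 n) (𝓡 n) e.symm x y⟩

/-- The local expression `L(x, y)` of a function on the tangent bundle in the chart `e`. -/
def localRep (e : OpenPartialHomeomorph M (Coord n)) (L : TangentBundle (𝓡 n) M → ℝ)
    (x y : Coord n) : ℝ :=
  L (coordVec e x y)

/-- `L` is a `C^∞` Finsler structure over the open cone `A` of nonzero tangent vectors: smooth,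
positive, positively homogeneous of degree one, with nondegenerate metric tensor `g_ij`.
The case of all nonzero tangent vectors and of positive definite `g_ij` is included. -/
structure IsFinslerOn [IsManifold (𝓡 n) ∞ M] (A : Set (TangentBundle (𝓡 n) M))
    (L : TangentBundle (𝓡 n) M → ℝ) : Prop where
  isOpen : IsOpen A
  ne_zero : ∀ v ∈ A, v.snd ≠ 0
  cone : ∀ v ∈ A, ∀ c : ℝ, 0 < c → (⟨v.proj, c • v.snd⟩ : TangentBundle (𝓡 n) M) ∈ A
  smooth : ContMDiffOn (𝓡 n).tangent 𝓘(ℝ, ℝ) ∞ L A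
  pos : ∀ v ∈ A, 0 < L v
  homogeneous : ∀ v ∈ A, ∀ c : ℝ, 0 < c → L ⟨v.proj, c • v.snd⟩ = c * L v
  nondegenerate : ∀ e ∈ IsManifold.maximalAtlas (𝓡 n) ∞ M, ∀ x ∈ e.target, ∀ y : Coord n,
    coordVec e x y ∈ A → (metric (localRep e L) x y).det ≠ 0

/-- A one-form, viewed as the fibrewise linear function `β(x, y) = b_i(x) y^i` on the tangent
bundle. -/
def oneFormFun (b : ∀ m : M, TangentSpace (𝓡 n) m →L[ℝ] ℝ) (v : TangentBundle (𝓡 n) M) : ℝ :=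
  b v.proj v.snd

/-- The transformed function `f(e^σ L, β)`. -/
def changed (f : ℝ → ℝ → ℝ) (σ : M → ℝ) (b : ∀ m : M, TangentSpace (𝓡 n) m →L[ℝ] ℝ)
    (L : TangentBundle (𝓡 n) M → ℝ) (v : TangentBundle (𝓡 n) M) : ℝ :=
  f (Real.exp (σ v.proj) * L v) (oneFormFun b v)

end Manifold

/-- `f` is `C^∞` and positively homogeneous of degree one on the open cone `Ω` of the plane. -/
structure IsHomogeneousOn (Ω : Set (ℝ × ℝ)) (f : ℝ → ℝ → ℝ) : Prop where
  isOpen : IsOpen Ω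
  cone : ∀ w ∈ Ω, ∀ c : ℝ, 0 < c → c • w ∈ Ω
  smooth : ContDiffOn ℝ ∞ (fun w : ℝ × ℝ => f w.1 w.2) Ω
  homogeneous : ∀ w ∈ Ω, ∀ c : ℝ, 0 < c → f (c * w.1) (c * w.2) = c * f w.1 w.2

/-- Partial derivative of a function of two real variables in the first variable. -/
def pd1 (f : ℝ → ℝ → ℝ) (s t : ℝ) : ℝ := deriv (fun u => f u t) s

/-- Partial derivative of a function of two real variables in the second variable. -/
def pd2 (f : ℝ → ℝ → ℝ) (s t : ℝ) : ℝ := deriv (fun u => f s u) t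

/-- The data of a generalized `β`-conformal change in a coordinate chart: the fundamental
function `L(x, y)`, the conformal factor `σ(x)`, the components `b_i(x)` and the function `f`. -/
structure ChangeData (n : ℕ) where
  L : Coord n → Coord n → ℝ
  σ : Coord n → ℝ
  b : Fin n → Coord n → ℝ
  f : ℝ → ℝ → ℝ

/-- The coordinate expression in the chart `e` of the data on the manifold. -/
def localData {M : Type*} [TopologicalSpace M] [ChartedSpace (Coord n) M]
    (e : OpenPartialHomeomorph M (Coord n)) (f : ℝ → ℝ → ℝ) (σ : M → ℝ)
    (b : ∀ m : M, TangentSpace (𝓡 n) m →L[ℝ] ℝ) (L : TangentBundle (𝓡 n) M → ℝ) :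
    ChangeData n where
  L := localRep e L
  σ := fun x => σ (e.symm x)
  b := fun i x => localRep e (oneFormFun b) x (EuclideanSpace.single i 1)
  f := f

namespace ChangeData

variable (c : ChangeData n)

/-- `β(x, y) = b_i(x) y^i`. -/
def β (x y : Coord n) : ℝ := ∑ i, c.b i x * y i

/-- `L̃ = e^σ L`. -/
def Lt (x y : Coord n) : ℝ := Real.exp (c.σ x) * c.L x y

/-- `e^σ`. -/
def es (x : Coord n) : ℝ := Real.exp (c.σ x)

/-! `f` and its partial derivatives at `(L̃, β)`. -/

def fv (x y : Coord n) : ℝ := c.f (c.Lt x y) (c.β x y)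
def f1 (x y : Coord n) : ℝ := pd1 c.f (c.Lt x y) (c.β x y)
def f2 (x y : Coord n) : ℝ := pd2 c.f (c.Lt x y) (c.β x y)
def f11 (x y : Coord n) : ℝ := pd1 (pd1 c.f) (c.Lt x y) (c.β x y)
def f12 (x y : Coord n) : ℝ := pd2 (pd1 c.f) (c.Lt x y) (c.β x y)
def f22 (x y : Coord n) : ℝ := pd2 (pd2 c.f) (c.Lt x y) (c.β x y)

/-! The scalars `q, p, q_0, p_0, q_{-1}, p_{-1}, q_{-2}, p_{-2}` and `p_02 = ∂p_0/∂β`. -/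

def q (x y : Coord n) : ℝ := c.fv x y * c.f2 x y
def p (x y : Coord n) : ℝ := c.fv x y * c.f1 x y / c.L x y
def q0 (x y : Coord n) : ℝ := c.fv x y * c.f22 x y
def p0 (x y : Coord n) : ℝ := c.f2 x y ^ 2 + c.q0 x y
def qm1 (x y : Coord n) : ℝ := c.fv x y * c.f12 x y / c.L x y
def pm1 (x y : Coord n) : ℝ := c.qm1 x y + c.p x y * c.f2 x y / c.fv x y
def p02 (x y : Coord n) : ℝ :=
  pd2 (fun s t => pd2 c.f s t ^ 2 + c.f s t * pd2 (pd2 c.f) s t) (c.Lt x y) (c.β x y)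

/-! The metric of `L`, with indices lowered and raised by `g_ij`. -/

/-- `g_ij`. -/
def g (x y : Coord n) (i j : Fin n) : ℝ := metric c.L x y i j

/-- `g^ij`. -/
def gi (x y : Coord n) (i j : Fin n) : ℝ := metricInv c.L x y i j

/-- `y_i = g_ij y^j`. -/
def yl (i : Fin n) (x y : Coord n) : ℝ := ∑ j, c.g x y i j * y j

/-- `b^i = g^ij b_j`. -/
def bu (i : Fin n) (x y : Coord n) : ℝ := ∑ j, c.gi x y i j * c.b j x

/-- `b² = b^i b_i`. -/
def bsq (x y : Coord n) : ℝ := ∑ i, c.bu i x y * c.b i x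

/-- The angular metric tensor `h_ij = g_ij - l_i l_j`, where `l_i = ∂̇_i L`. -/
def h (i j : Fin n) (x y : Coord n) : ℝ := c.g x y i j - dy i c.L x y * dy j c.L x y

/-- `m_i = b_i - (β / L²) y_i`. -/
def m (i : Fin n) (x y : Coord n) : ℝ :=
  c.b i x - c.β x y / c.L x y ^ 2 * c.yl i x y

/-- `m² = g^ij m_i m_j`. -/
def msq (x y : Coord n) : ℝ := ∑ i, ∑ j, c.gi x y i j * c.m i x y * c.m j x y

/-- `ε = f² (e^σ p + m² q_0) / L²`. -/
def ε (x y : Coord n) : ℝ :=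
  c.fv x y ^ 2 * (c.es x * c.p x y + c.msq x y * c.q0 x y) / c.L x y ^ 2

/-- `s_0 = e^{-σ} f² q_0 / (ε p L²)`. -/
def s0 (x y : Coord n) : ℝ :=
  Real.exp (-c.σ x) * c.fv x y ^ 2 * c.q0 x y / (c.ε x y * c.p x y * c.L x y ^ 2)

/-- `s_{-1} = p_{-1} f² / (p ε L²)`. -/
def sm1 (x y : Coord n) : ℝ :=
  c.pm1 x y * c.fv x y ^ 2 / (c.p x y * c.ε x y * c.L x y ^ 2)

/-- `s_{-2} = p_{-1} (e^σ m² p L² - b² f²) / (ε p β L²)` where `β ≠ 0`. The singularity at `β = 0`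
is removable (by homogeneity of `f` the numerator is `-p_{-1} β (e^σ p β + b² q)`), and there
`s_{-2}` has the value of the continuous extension. -/
def sm2 (x y : Coord n) : ℝ :=
  if c.β x y = 0 then
    -(c.pm1 x y * c.bsq x y * c.q x y) / (c.ε x y * c.p x y * c.L x y ^ 2)
  else
    c.pm1 x y * (c.es x * c.msq x y * c.p x y * c.L x y ^ 2 - c.bsq x y * c.fv x y ^ 2) /
      (c.ε x y * c.p x y * c.β x y * c.L x y ^ 2)

/-! Derivatives of `σ` and `b`. -/

/-- `σ_i = ∂_i σ`. -/
def σd (i : Fin n) (x y : Coord n) : ℝ := dx i (fun x _ => c.σ x) x y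

/-- `σ^i = g^ij σ_j`. -/
def σu (i : Fin n) (x y : Coord n) : ℝ := ∑ j, c.gi x y i j * c.σd j x y

/-- `σ_0 = σ_i y^i`. -/
def σ0 (x y : Coord n) : ℝ := ∑ i, c.σd i x y * y i

/-- `σ_β = σ_r b^r`. -/
def σβ (x y : Coord n) : ℝ := ∑ r, c.σd r x y * c.bu r x y

/-- The horizontal covariant derivative `b_{i|j} = δ_j b_i - b_r Γ^r_ij` with respect to the
Cartan connection of `L`. -/
def bcov (i j : Fin n) (x y : Coord n) : ℝ :=
  hder c.L j (fun x _ => c.b i x) x y - ∑ r, c.b r x * cartanGamma c.L r i j x y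

/-- `b_{0|j} = b_{i|j} y^i`. -/
def b0cov (j : Fin n) (x y : Coord n) : ℝ := ∑ i, c.bcov i j x y * y i

/-- `E_ij`, with `2 E_ij = b_{i|j} + b_{j|i}`. -/
def E (i j : Fin n) (x y : Coord n) : ℝ := (c.bcov i j x y + c.bcov j i x y) / 2

/-- `F_ij`, with `2 F_ij = b_{i|j} - b_{j|i}`. -/
def F (i j : Fin n) (x y : Coord n) : ℝ := (c.bcov i j x y - c.bcov j i x y) / 2

/-- `E_i0 = E_ik y^k`. -/
def E0 (i : Fin n) (x y : Coord n) : ℝ := ∑ k, c.E i k x y * y k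

/-- `E_00 = E_jk y^j y^k`. -/
def E00 (x y : Coord n) : ℝ := ∑ j, ∑ k, c.E j k x y * y j * y k

/-- `F_i0 = F_ik y^k`. -/
def F0 (i : Fin n) (x y : Coord n) : ℝ := ∑ k, c.F i k x y * y k

/-- `F^i_0 = g^ij F_jk y^k`. -/
def Fu0 (i : Fin n) (x y : Coord n) : ℝ := ∑ j, ∑ k, c.gi x y i j * c.F j k x y * y k

/-- `F_β0 = F_r0 b^r`. -/
def Fβ0 (x y : Coord n) : ℝ := ∑ r, c.F0 r x y * c.bu r x y

/-! The auxiliary tensors and the difference tensors. -/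

/-- `B_ij`, with `2 B_ij = e^σ p_{-1} h_ij + p_02 m_i m_j`. -/
def B (i j : Fin n) (x y : Coord n) : ℝ :=
  (c.es x * c.pm1 x y * c.h i j x y + c.p02 x y * c.m i x y * c.m j x y) / 2

/-- `Q_i = e^σ p_{-1} y_i + p_0 b_i`. -/
def Q (i : Fin n) (x y : Coord n) : ℝ :=
  c.es x * c.pm1 x y * c.yl i x y + c.p0 x y * c.b i x

/-- `V_ijk = (e^σ p_{-1} / 2) (h_ij m_k + h_jk m_i + h_ki m_j) + (p_02 / 2) m_i m_j m_k`. -/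
def V (i j k : Fin n) (x y : Coord n) : ℝ :=
  c.es x * c.pm1 x y / 2 *
      (c.h i j x y * c.m k x y + c.h j k x y * c.m i x y + c.h k i x y * c.m j x y)
    + c.p02 x y / 2 * c.m i x y * c.m j x y * c.m k x y

/-- The difference `D^i` of the canonical sprays. -/
def D (i : Fin n) (x y : Coord n) : ℝ :=
  c.σ0 x y / (2 * c.p x y) *
      ((2 * c.p x y - c.β x y * c.pm1 x y
          - c.es x * c.p x y ^ 2 * c.L x y ^ 2 * c.sm2 x y
          - c.p x y * c.sm1 x y *
            (2 * c.es x * c.p x y * c.β x y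
              + c.es x * c.pm1 x y * c.L x y ^ 2 * c.msq x y)) * y i
        - 2 * c.es x * c.p x y ^ 2 * c.β x y * c.s0 x y * c.bu i x y)
    + c.q x y / c.p x y * Real.exp (-c.σ x) * c.Fu0 i x y
    - (1 / 2) * c.L x y ^ 2 * c.σu i x y
    + (1 / 2) *
      (c.es x * c.p x y * c.E00 x y - 2 * c.q x y * c.Fβ0 x y
        + c.es x * c.p x y * c.L x y ^ 2 * c.σβ x y) *
      (c.s0 x y * c.bu i x y + c.sm1 x y * y i)

/-- The tensor `A_ij`. -/
def A (i j : Fin n) (x y : Coord n) : ℝ :=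
  c.E00 x y * c.B i j x y + c.F0 i x y * c.Q j x y + c.q x y * c.F i j x y
    + c.E0 j x y * c.Q i x y
    - 2 * ∑ s, (c.es x * c.p x y * cartan c.L s i j x y + c.V s i j x y) * c.D s x y
    + (1 / 2) * c.σ0 x y *
      (2 * c.es x * c.p x y * c.g x y i j + 2 * c.es x * c.pm1 x y * c.m j x y * c.yl i x y
        - 2 * c.β x y * c.B i j x y
        + c.es x * c.pm1 x y * (c.b i x * c.yl j x y - c.b j x * c.yl i x y))
    - (1 / 2) * c.σd i x y *
      (c.es x * c.L x y ^ 2 * c.pm1 x y * c.m j x y + 2 * c.es x * c.p x y * c.yl j x y)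
    + (1 / 2) * c.σd j x y *
      (2 * c.es x * c.p x y * c.yl i x y + c.es x * c.L x y ^ 2 * c.pm1 x y * c.m i x y)

/-- `A^i_j = g^li A_lj`. -/
def Au (i j : Fin n) (x y : Coord n) : ℝ := ∑ l, c.gi x y l i * c.A l j x y

/-- The difference `D^i_j` of the Barthel connections. -/
def DN (i j : Fin n) (x y : Coord n) : ℝ :=
  Real.exp (-c.σ x) / c.p x y * c.Au i j x y
    - (c.s0 x y * c.bu i x y + c.sm1 x y * y i) * ∑ r, c.A r j x y * c.bu r x y
    - (c.q x y * c.b0cov j x y + c.es x * c.p x y * c.L x y ^ 2 * c.σd j x y) *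
      (c.sm1 x y * c.bu i x y + c.sm2 x y * y i)

end ChangeData

end BetaConformal

end

/-! The difference of the two sprays is computed with its index lowered by the changed metric ḡ;
only at the end is ḡ inverted.

Euler's theorem turns the definition of the spray into the Euler–Lagrange form 4 g_ir G^r = y^k ∂_k
∂̇_i L² − ∂_i L² (`sum_metric_mul_spray`), which holds for L and for the changed function L̄. Since
L is constant along the horizontal directions of its own Barthel connection (`dx_eq`), the
horizontal derivative of L̄² sees only σ and β: it equals 2(e^σ p L² σ_k + q b_{0|k}) (`dx_fv_sq`).
Inserting this in the formula for L̄ gives ḡ_ir (Ḡ^r − G^r) = ½ X_i with X_i explicit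
(`sum_metric_fv_mul_spray_sub`).

This identity needs no division by p, so it holds on the whole open set and may be differentiated in
y^j. The result is ḡ_ir (N̄^r_j − N^r_j) = ½ ∂̇_j X_i − 2 C̄_sij D^s = A_ij (`hasDy_X`, `cartan_fv`,
`sum_metric_fv_mul_barthel_sub`). Only the value of D^s at the point enters, and so p ≠ 0 is needed
only there; the long formula for D^i is never differentiated.

For the inversion, ḡ is e^σ p g plus a correction built from b_i and y_i, and its inverse has the
same shape with coefficients s_0, s_{-1}, s_{-2}. Multiplying out (`sum_metric_fv_mul_inverse`)
leaves four scalar relations, which follow from Euler's identities for f and q = f f_2. The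
denominators are safe because a zero of e^σ p + m² q_0 would give ḡ a kernel (`Δ_ne_zero`). The
inverse applied to ½ X_i gives D^i (`D_eq`), and applied to A_ij it gives D^i_j, where
`sum_A_mul_coord` evaluates A_ij y^i. -/

noncomputable section

namespace BetaConformal

variable {n : ℕ}

section Calculus

/-! ### Directional derivatives of functions of `(x, y)` -/

/-- `H`, as a function of the pair `(x, y)`, is differentiable at `(x, y)`, and its derivative in
the direction `v` is `a`. -/
def HasDir (H : Coord n → Coord n → ℝ) (x y : Coord n) (v : Coord n × Coord n) (a : ℝ) : Prop :=
  ∃ F : (Coord n × Coord n) →L[ℝ] ℝ,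
    HasFDerivAt (fun z : Coord n × Coord n => H z.1 z.2) F (x, y) ∧ F v = a

/-- The direction of `∂_i`. -/
def vx (i : Fin n) : Coord n × Coord n := (EuclideanSpace.single i 1, 0)

/-- The direction of `∂̇_i`. -/
def vy (i : Fin n) : Coord n × Coord n := (0, EuclideanSpace.single i 1)

variable {H K : Coord n → Coord n → ℝ} {x y : Coord n} {v : Coord n × Coord n} {a a' : ℝ}

namespace HasDir

lemma dx_eq {i : Fin n} (h : HasDir H x y (vx i) a) : dx i H x y = a := by
  obtain ⟨F, hF, rfl⟩ := h
  have := hF.comp x (hasFDerivAt_prodMk_left (𝕜 := ℝ) x y)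
  have h2 := this.fderiv
  simp only [Function.comp_def] at h2
  rw [dx, h2]
  simp [vx]

lemma dy_eq {i : Fin n} (h : HasDir H x y (vy i) a) : dy i H x y = a := by
  obtain ⟨F, hF, rfl⟩ := h
  have := hF.comp y (hasFDerivAt_prodMk_right (𝕜 := ℝ) x y)
  have h2 := this.fderiv
  simp only [Function.comp_def] at h2
  rw [dy, h2]
  simp [vy]

lemma congr_val (h : HasDir H x y v a) (e : a = a') : HasDir H x y v a' := e ▸ h

lemma coord (k : Fin n) : HasDir (fun _ y => y k) x y v (v.2 k) := by
  let F : (Coord n × Coord n) →L[ℝ] ℝ :=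
    (EuclideanSpace.proj (𝕜 := ℝ) k).comp (ContinuousLinearMap.snd ℝ (Coord n) (Coord n))
  exact ⟨F, F.hasFDerivAt, rfl⟩

lemma add (h : HasDir H x y v a) (k : HasDir K x y v a') :
    HasDir (fun x y => H x y + K x y) x y v (a + a') := by
  obtain ⟨F, hF, rfl⟩ := h
  obtain ⟨F', hF', rfl⟩ := k
  exact ⟨_, hF.add hF', rfl⟩

lemma sub (h : HasDir H x y v a) (k : HasDir K x y v a') :
    HasDir (fun x y => H x y - K x y) x y v (a - a') := by
  obtain ⟨F, hF, rfl⟩ := h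
  obtain ⟨F', hF', rfl⟩ := k
  exact ⟨_, hF.sub hF', rfl⟩

lemma mul (h : HasDir H x y v a) (k : HasDir K x y v a') :
    HasDir (fun x y => H x y * K x y) x y v (a * K x y + H x y * a') := by
  obtain ⟨F, hF, rfl⟩ := h
  obtain ⟨F', hF', rfl⟩ := k
  refine ⟨_, hF.mul hF', ?_⟩
  simp
  ring

lemma const_mul (r : ℝ) (h : HasDir H x y v a) :
    HasDir (fun x y => r * H x y) x y v (r * a) := by
  obtain ⟨F, hF, rfl⟩ := h
  exact ⟨_, hF.const_mul r, rfl⟩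

lemma inv (h : HasDir H x y v a) (h0 : H x y ≠ 0) :
    HasDir (fun x y => (H x y)⁻¹) x y v (-a / H x y ^ 2) := by
  obtain ⟨F, hF, rfl⟩ := h
  refine ⟨_, (hasDerivAt_inv h0).comp_hasFDerivAt (x, y) hF, ?_⟩
  simp
  ring

lemma sum {ι : Type*} {s : Finset ι} {H : ι → Coord n → Coord n → ℝ} {a : ι → ℝ}
    (h : ∀ i, HasDir (H i) x y v (a i)) :
    HasDir (fun x y => ∑ i ∈ s, H i x y) x y v (∑ i ∈ s, a i) := by
  choose F hF hv using h
  refine ⟨∑ i ∈ s, F i, HasFDerivAt.fun_sum fun i _ => hF i, ?_⟩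
  simp [hv]

lemma exp (h : HasDir H x y v a) :
    HasDir (fun x y => Real.exp (H x y)) x y v (Real.exp (H x y) * a) := by
  obtain ⟨F, hF, rfl⟩ := h
  exact ⟨_, hF.exp, rfl⟩

/-- Joint differentiability of f makes its two partial derivatives the values of one linear map on
the basis vectors, so the chain rule splits along them. -/
lemma comp₂ {f : ℝ → ℝ → ℝ}
    (hf : DifferentiableAt ℝ (fun w : ℝ × ℝ => f w.1 w.2) (H x y, K x y))
    (h : HasDir H x y v a) (k : HasDir K x y v a') :
    HasDir (fun x y => f (H x y) (K x y)) x y v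
      (pd1 f (H x y) (K x y) * a + pd2 f (H x y) (K x y) * a') := by
  obtain ⟨F, hF, rfl⟩ := h
  obtain ⟨F', hF', rfl⟩ := k
  have hc : HasFDerivAt (fun z : Coord n × Coord n => f (H z.1 z.2) (K z.1 z.2))
      ((fderiv ℝ (fun w : ℝ × ℝ => f w.1 w.2) (H x y, K x y)).comp (F.prod F')) (x, y) :=
    HasFDerivAt.comp (g := fun w : ℝ × ℝ => f w.1 w.2) (x, y) hf.hasFDerivAt (hF.prodMk hF')
  refine ⟨_, hc, ?_⟩
  have h1 : pd1 f (H x y) (K x y)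
      = fderiv ℝ (fun w : ℝ × ℝ => f w.1 w.2) (H x y, K x y) (1, 0) := by
    have := (hf.hasFDerivAt.comp (H x y)
      (hasFDerivAt_prodMk_left (𝕜 := ℝ) (H x y) (K x y))).hasDerivAt.deriv
    simpa [pd1, Function.comp_def] using this
  have h2 : pd2 f (H x y) (K x y)
      = fderiv ℝ (fun w : ℝ × ℝ => f w.1 w.2) (H x y, K x y) (0, 1) := by
    have := (hf.hasFDerivAt.comp (K x y)
      (hasFDerivAt_prodMk_right (𝕜 := ℝ) (H x y) (K x y))).hasDerivAt.deriv
    simpa [pd2, Function.comp_def] using this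
  rw [h1, h2]
  simp only [ContinuousLinearMap.comp_apply, ContinuousLinearMap.prod_apply]
  have : ((F v, F' v) : ℝ × ℝ) = F v • ((1 : ℝ), (0 : ℝ)) + F' v • ((0 : ℝ), (1 : ℝ)) := by
    simp
  rw [this, map_add, map_smul, map_smul, smul_eq_mul, smul_eq_mul]
  ring

lemma congr {U : Set (Coord n × Coord n)} (hU : IsOpen U) (h : HasDir H x y v a)
    (hz : (x, y) ∈ U) (e : ∀ x y, (x, y) ∈ U → K x y = H x y) : HasDir K x y v a := by
  obtain ⟨F, hF, rfl⟩ := h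
  refine ⟨F, hF.congr_of_eventuallyEq ?_, rfl⟩
  filter_upwards [hU.mem_nhds hz] with z hz using e z.1 z.2 hz

/-- Together with `HasDir.congr` this is the device for differentiating an identity that holds on an
open set: both sides are differentiated by the rules above and the results equated. -/
lemma unique (h : HasDir H x y v a) (h' : HasDir H x y v a') : a = a' := by
  obtain ⟨F, hF, rfl⟩ := h
  obtain ⟨F', hF', rfl⟩ := h'
  rw [hF.unique hF']

end HasDir

/-! ### Smooth functions of `(x, y)` -/

/-- `H` is a smooth function of the pair `(x, y)` on `U`. -/
def Sm (U : Set (Coord n × Coord n)) (H : Coord n → Coord n → ℝ) : Prop :=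
  ContDiffOn ℝ ∞ (fun z : Coord n × Coord n => H z.1 z.2) U

variable {U : Set (Coord n × Coord n)}

namespace Sm

lemma differentiableAt (hU : IsOpen U) (h : Sm U H) (hz : (x, y) ∈ U) :
    DifferentiableAt ℝ (fun z : Coord n × Coord n => H z.1 z.2) (x, y) :=
  (h.contDiffAt (hU.mem_nhds hz)).differentiableAt (by simp)

lemma hasDir_fderiv (hU : IsOpen U) (h : Sm U H) (hz : (x, y) ∈ U) (v : Coord n × Coord n) :
    HasDir H x y v (fderiv ℝ (fun z : Coord n × Coord n => H z.1 z.2) (x, y) v) :=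
  ⟨_, (h.differentiableAt hU hz).hasFDerivAt, rfl⟩

lemma hasDx (hU : IsOpen U) (h : Sm U H) (hz : (x, y) ∈ U) (i : Fin n) :
    HasDir H x y (vx i) (dx i H x y) :=
  (h.hasDir_fderiv hU hz _).congr_val (h.hasDir_fderiv hU hz _).dx_eq.symm

lemma hasDy (hU : IsOpen U) (h : Sm U H) (hz : (x, y) ∈ U) (i : Fin n) :
    HasDir H x y (vy i) (dy i H x y) :=
  (h.hasDir_fderiv hU hz _).congr_val (h.hasDir_fderiv hU hz _).dy_eq.symm

lemma congr (h : Sm U H) (e : ∀ x y, (x, y) ∈ U → K x y = H x y) : Sm U K :=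
  ContDiffOn.congr h fun z hz => e z.1 z.2 hz

lemma const (r : ℝ) : Sm U (fun _ _ => r) := contDiffOn_const

lemma coord (k : Fin n) : Sm U (fun _ y => y k) :=
  ((EuclideanSpace.proj (𝕜 := ℝ) k).comp
    (ContinuousLinearMap.snd ℝ (Coord n) (Coord n))).contDiff.contDiffOn

lemma add (h : Sm U H) (k : Sm U K) : Sm U (fun x y => H x y + K x y) := ContDiffOn.add h k

lemma sub (h : Sm U H) (k : Sm U K) : Sm U (fun x y => H x y - K x y) := ContDiffOn.sub h k

lemma mul (h : Sm U H) (k : Sm U K) : Sm U (fun x y => H x y * K x y) := ContDiffOn.mul h k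

lemma pow (h : Sm U H) (k : ℕ) : Sm U (fun x y => H x y ^ k) := ContDiffOn.pow h k

lemma inv (h : Sm U H) (h0 : ∀ x y, (x, y) ∈ U → H x y ≠ 0) : Sm U (fun x y => (H x y)⁻¹) :=
  ContDiffOn.inv h fun z hz => h0 z.1 z.2 hz

lemma exp (h : Sm U H) : Sm U (fun x y => Real.exp (H x y)) := ContDiffOn.exp h

lemma sum {ι : Type*} {s : Finset ι} {H : ι → Coord n → Coord n → ℝ} (h : ∀ i, Sm U (H i)) :
    Sm U (fun x y => ∑ i ∈ s, H i x y) := ContDiffOn.sum fun i _ => h i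

lemma prod {ι : Type*} {s : Finset ι} {H : ι → Coord n → Coord n → ℝ} (h : ∀ i, Sm U (H i)) :
    Sm U (fun x y => ∏ i ∈ s, H i x y) := contDiffOn_prod fun i _ => h i

lemma fderiv_apply (hU : IsOpen U) (h : Sm U H) (v : Coord n × Coord n) :
    Sm U (fun x y => fderiv ℝ (fun z : Coord n × Coord n => H z.1 z.2) (x, y) v) := by
  have : ContDiffOn ℝ ∞ (fderiv ℝ (fun z : Coord n × Coord n => H z.1 z.2)) U :=
    h.fderiv_of_isOpen hU (by simp)
  exact this.clm_apply contDiffOn_const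

lemma dx (hU : IsOpen U) (h : Sm U H) (i : Fin n) : Sm U (dx i H) :=
  (h.fderiv_apply hU (vx i)).congr fun _ _ hz => (h.hasDir_fderiv hU hz _).dx_eq

lemma dy (hU : IsOpen U) (h : Sm U H) (i : Fin n) : Sm U (dy i H) :=
  (h.fderiv_apply hU (vy i)).congr fun _ _ hz => (h.hasDir_fderiv hU hz _).dy_eq

lemma hasDir_fderiv_apply (hU : IsOpen U) (h : Sm U H) (hz : (x, y) ∈ U)
    (v w : Coord n × Coord n) :
    HasDir (fun x y => fderiv ℝ (fun z : Coord n × Coord n => H z.1 z.2) (x, y) v) x y w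
      (fderiv ℝ (fderiv ℝ (fun z : Coord n × Coord n => H z.1 z.2)) (x, y) w v) := by
  have : ContDiffOn ℝ ∞ (fderiv ℝ (fun z : Coord n × Coord n => H z.1 z.2)) U :=
    h.fderiv_of_isOpen hU (by simp)
  have hd := ((this.contDiffAt (hU.mem_nhds hz)).differentiableAt (by simp)).hasFDerivAt
  refine ⟨_, hd.clm_apply (hasFDerivAt_const v _), ?_⟩
  simp

/-- Schwarz's theorem on the product space; with v and w among the coordinate directions it yields
every commutation of the x- and y-derivatives. -/
lemma fderiv_fderiv_comm (hU : IsOpen U) (h : Sm U H) (hz : (x, y) ∈ U)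
    (v w : Coord n × Coord n) :
    fderiv ℝ (fderiv ℝ (fun z : Coord n × Coord n => H z.1 z.2)) (x, y) w v
      = fderiv ℝ (fderiv ℝ (fun z : Coord n × Coord n => H z.1 z.2)) (x, y) v w :=
  (h.contDiffAt (hU.mem_nhds hz)).isSymmSndFDerivAt
    (by simp only [minSmoothness_of_isRCLikeNormedField]; exact ENat.LEInfty.out) w v

lemma hasDir_dx (hU : IsOpen U) (h : Sm U H) (hz : (x, y) ∈ U) (i : Fin n)
    (w : Coord n × Coord n) :
    HasDir (BetaConformal.dx i H) x y w
      (fderiv ℝ (fderiv ℝ (fun z : Coord n × Coord n => H z.1 z.2)) (x, y) w (vx i)) :=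
  (h.hasDir_fderiv_apply hU hz (vx i) w).congr hU hz
    fun _ _ hz => (h.hasDir_fderiv hU hz _).dx_eq

lemma hasDir_dy (hU : IsOpen U) (h : Sm U H) (hz : (x, y) ∈ U) (i : Fin n)
    (w : Coord n × Coord n) :
    HasDir (BetaConformal.dy i H) x y w
      (fderiv ℝ (fderiv ℝ (fun z : Coord n × Coord n => H z.1 z.2)) (x, y) w (vy i)) :=
  (h.hasDir_fderiv_apply hU hz (vy i) w).congr hU hz
    fun _ _ hz => (h.hasDir_fderiv hU hz _).dy_eq

lemma dy_dy_comm (hU : IsOpen U) (h : Sm U H) (hz : (x, y) ∈ U) (i j : Fin n) :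
    BetaConformal.dy i (BetaConformal.dy j H) x y
      = BetaConformal.dy j (BetaConformal.dy i H) x y := by
  rw [(h.hasDir_dy hU hz j (vy i)).dy_eq, (h.hasDir_dy hU hz i (vy j)).dy_eq,
    h.fderiv_fderiv_comm hU hz]

lemma dy_dx_comm (hU : IsOpen U) (h : Sm U H) (hz : (x, y) ∈ U) (i j : Fin n) :
    BetaConformal.dy i (BetaConformal.dx j H) x y
      = BetaConformal.dx j (BetaConformal.dy i H) x y := by
  rw [(h.hasDir_dx hU hz j (vy i)).dy_eq, (h.hasDir_dy hU hz i (vx j)).dx_eq,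
    h.fderiv_fderiv_comm hU hz]

end Sm

lemma dx_congr (hU : IsOpen U) (hz : (x, y) ∈ U) (e : ∀ x y, (x, y) ∈ U → H x y = K x y)
    (i : Fin n) : dx i H x y = dx i K x y := by
  have : (fun z => H z y) =ᶠ[nhds x] fun z => K z y := by
    have hc : ContinuousAt (fun z : Coord n => (z, y)) x := by fun_prop
    filter_upwards [hc.preimage_mem_nhds (hU.mem_nhds hz)] with z hz using e _ _ hz
  rw [dx, dx, this.fderiv_eq]

lemma dy_congr (hU : IsOpen U) (hz : (x, y) ∈ U) (e : ∀ x y, (x, y) ∈ U → H x y = K x y)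
    (i : Fin n) : dy i H x y = dy i K x y := by
  have : H x =ᶠ[nhds y] K x := by
    have hc : ContinuousAt (fun z : Coord n => (x, z)) y := by fun_prop
    filter_upwards [hc.preimage_mem_nhds (hU.mem_nhds hz)] with z hz using e _ _ hz
  change fderiv ℝ (H x) y _ = fderiv ℝ (K x) y _
  rw [this.fderiv_eq]

/-! ### Homogeneity in the fibre coordinates -/

/-- `H` is positively homogeneous of degree `k` in `y` on `U`. -/
def Hom (U : Set (Coord n × Coord n)) (k : ℕ) (H : Coord n → Coord n → ℝ) : Prop :=
  ∀ x y, (x, y) ∈ U → ∀ c : ℝ, 0 < c → H x (c • y) = c ^ k * H x y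

/-- `U` is closed under multiplication of `y` by positive scalars. -/
def Conic (U : Set (Coord n × Coord n)) : Prop :=
  ∀ x y, (x, y) ∈ U → ∀ c : ℝ, 0 < c → (x, c • y) ∈ U

lemma sum_coord_mul_clm (F : Coord n →L[ℝ] ℝ) (y : Coord n) :
    ∑ j, y j * F (EuclideanSpace.single j 1) = F y := by
  conv_rhs => rw [← (EuclideanSpace.basisFun (Fin n) ℝ).sum_repr y]
  simp [map_sum]

lemma Sm.hasFDerivAt_right (hU : IsOpen U) (h : Sm U H) (hz : (x, y) ∈ U) :
    HasFDerivAt (H x) (fderiv ℝ (H x) y) y := by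
  have := (h.differentiableAt hU hz).comp y (hasFDerivAt_prodMk_right (𝕜 := ℝ) x y).differentiableAt
  exact this.hasFDerivAt

/-- Euler's theorem: c ↦ H(x, c y) is differentiated at c = 1 by the chain rule and by homogeneity.
-/
lemma Hom.euler {k : ℕ} (hU : IsOpen U) (hs : Sm U H) (hh : Hom U k H) (hz : (x, y) ∈ U) :
    ∑ j, y j * BetaConformal.dy j H x y = k * H x y := by
  have h1 : HasDerivAt (fun c : ℝ => H x (c • y)) (fderiv ℝ (H x) y y) 1 := by
    have hc : HasDerivAt (fun c : ℝ => c • y) y 1 := by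
      simpa using (hasDerivAt_id (1 : ℝ)).smul_const y
    have hF := hs.hasFDerivAt_right hU hz
    rw [← one_smul ℝ y] at hF
    exact (hF.comp_hasDerivAt (1 : ℝ) hc).congr_deriv (by rw [one_smul])
  have h2 : HasDerivAt (fun c : ℝ => c ^ k * H x y) (k * H x y) 1 := by
    simpa using (hasDerivAt_pow k (1 : ℝ)).mul_const (H x y)
  have h3 : (fun c : ℝ => c ^ k * H x y) =ᶠ[nhds 1] fun c : ℝ => H x (c • y) := by
    filter_upwards [lt_mem_nhds (zero_lt_one (α := ℝ))] with c hc using (hh x y hz c hc).symm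
  rw [← (h1.congr_of_eventuallyEq h3).unique h2]
  exact sum_coord_mul_clm (fderiv ℝ (H x) y) y

/-- Differentiating H(x, c w) = c^(k+1) H(x, w) in w brings out a factor c on the left, which is
cancelled. -/
lemma Hom.dy {k : ℕ} (hU : IsOpen U) (hC : Conic U) (hs : Sm U H) (hh : Hom U (k + 1) H)
    (i : Fin n) : Hom U k (dy i H) := by
  intro x y hz c hc
  have h1 := (hs.hasFDerivAt_right hU (hC x y hz c hc)).comp y
    ((ContinuousLinearMap.id ℝ (Coord n)).hasFDerivAt.const_smul c)
  have h2 := (hs.hasFDerivAt_right hU hz).const_mul (c ^ (k + 1))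
  have h3 : (fun w => c ^ (k + 1) * H x w) =ᶠ[nhds y] fun w => H x (c • w) := by
    have hc' : ContinuousAt (fun z : Coord n => (x, z)) y := by fun_prop
    filter_upwards [hc'.preimage_mem_nhds (hU.mem_nhds hz)] with w hw using (hh x w hw c hc).symm
  have h4 := (h1.congr_of_eventuallyEq h3).unique h2
  have h5 := congrArg (fun F : Coord n →L[ℝ] ℝ => F (EuclideanSpace.single i 1)) h4
  simp only [ContinuousLinearMap.comp_apply, smul_apply,
    ContinuousLinearMap.id_apply, map_smul, smul_eq_mul] at h5
  change fderiv ℝ (H x) (c • y) _ = c ^ k * fderiv ℝ (H x) y _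
  have : c * fderiv ℝ (H x) (c • y) (EuclideanSpace.single i 1)
      = c * (c ^ k * fderiv ℝ (H x) y (EuclideanSpace.single i 1)) := by
    rw [h5]; ring
  exact mul_left_cancel₀ hc.ne' this

lemma Hom.dx {k : ℕ} (hU : IsOpen U) (hs : Sm U H) (hh : Hom U k H)
    (i : Fin n) : Hom U k (dx i H) := by
  intro x y hz c hc
  have h3 : (fun w => H w (c • y)) =ᶠ[nhds x] fun w => c ^ k * H w y := by
    have hc' : ContinuousAt (fun z : Coord n => (z, y)) x := by fun_prop
    filter_upwards [hc'.preimage_mem_nhds (hU.mem_nhds hz)] with w hw using hh w y hw c hc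
  rw [BetaConformal.dx, h3.fderiv_eq]
  have hd := (hs.differentiableAt hU hz).comp x
    (hasFDerivAt_prodMk_left (𝕜 := ℝ) x y).differentiableAt
  have := (hd.hasFDerivAt.const_mul (c ^ k)).fderiv
  simp only [Function.comp_def] at this
  rw [this]
  rfl

end Calculus

section LocalFinsler

/-! ### Local Finsler geometry -/

/-- A function `L(x, y)` on an open conic set of coordinates which is smooth, positive, positively
homogeneous of degree one in `y`, and has nondegenerate metric tensor. -/
structure IsLocalFinsler (U : Set (Coord n × Coord n)) (L : Coord n → Coord n → ℝ) : Prop where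
  isOpen : IsOpen U
  conic : Conic U
  smooth : Sm U L
  pos : ∀ x y, (x, y) ∈ U → 0 < L x y
  hom : Hom U 1 L
  nondegenerate : ∀ x y, (x, y) ∈ U → (metric L x y).det ≠ 0

variable {U : Set (Coord n × Coord n)} {L : Coord n → Coord n → ℝ} {x y : Coord n}

lemma Sm.det {A : Coord n → Coord n → Matrix (Fin n) (Fin n) ℝ}
    (h : ∀ i j, Sm U fun x y => A x y i j) : Sm U fun x y => (A x y).det := by
  simp only [Matrix.det_apply']
  exact Sm.sum fun s => (Sm.const _).mul (Sm.prod fun i => h _ _)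

/-- Cramer's rule: the entries of the adjugate are determinants of A with one row replaced by a
constant one. -/
lemma Sm.matrix_inv {A : Coord n → Coord n → Matrix (Fin n) (Fin n) ℝ}
    (h : ∀ i j, Sm U fun x y => A x y i j) (h0 : ∀ x y, (x, y) ∈ U → (A x y).det ≠ 0)
    (i j : Fin n) : Sm U fun x y => (A x y)⁻¹ i j := by
  simp only [Matrix.inv_def, Ring.inverse_eq_inv', Matrix.smul_apply, smul_eq_mul,
    Matrix.adjugate_apply]
  refine ((Sm.det h).inv h0).mul (Sm.det fun k l => ?_)
  by_cases hk : k = j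
  · subst hk
    simpa [Matrix.updateRow_self] using Sm.const _
  · simpa [Matrix.updateRow_ne hk] using h k l

lemma sum_vy_mul (j : Fin n) (a : Fin n → ℝ) : ∑ k, (vy j).2 k * a k = a j := by
  simp [vy]

lemma dy_dy_sq (L : Coord n → Coord n → ℝ) (i j : Fin n) :
    dy i (dy j fun x y => L x y ^ 2) x y = 2 * metric L x y i j := by
  simp only [metric, Matrix.of_apply]
  ring

lemma dy_metric (L : Coord n → Coord n → ℝ) (i j k : Fin n) :
    dy k (fun x y => metric L x y i j) x y = 2 * cartan L i j k x y := by
  simp only [cartan]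
  ring

namespace IsLocalFinsler

variable (hL : IsLocalFinsler U L)
include hL

lemma sm_sq : Sm U fun x y => L x y ^ 2 := hL.smooth.pow 2

lemma hom_sq : Hom U 2 fun x y => L x y ^ 2 := by
  intro x y hz c hc
  simp only [hL.hom x y hz c hc]
  ring

lemma sm_dy_sq (i : Fin n) : Sm U (dy i fun x y => L x y ^ 2) := hL.sm_sq.dy hL.isOpen i

lemma hom_dy_sq (i : Fin n) : Hom U 1 (dy i fun x y => L x y ^ 2) :=
  Hom.dy hL.isOpen hL.conic hL.sm_sq hL.hom_sq i

lemma sm_metric (i j : Fin n) : Sm U fun x y => metric L x y i j :=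
  (Sm.const (1 / 2)).mul ((hL.sm_dy_sq j).dy hL.isOpen i)

lemma hom_metric (i j : Fin n) : Hom U 0 fun x y => metric L x y i j := by
  intro x y hz c hc
  have := Hom.dy hL.isOpen hL.conic (hL.sm_dy_sq j) (hL.hom_dy_sq j) i x y hz c hc
  simp only [metric, Matrix.of_apply, this]
  ring

lemma dy_sq (hz : (x, y) ∈ U) (i : Fin n) :
    dy i (fun x y => L x y ^ 2) x y = 2 * L x y * dy i L x y := by
  have h := hL.smooth.hasDy hL.isOpen hz i
  rw [((h.mul h).congr hL.isOpen hz fun x y _ => sq (L x y)).dy_eq]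
  ring

lemma dx_sq (hz : (x, y) ∈ U) (i : Fin n) :
    dx i (fun x y => L x y ^ 2) x y = 2 * L x y * dx i L x y := by
  have h := hL.smooth.hasDx hL.isOpen hz i
  rw [((h.mul h).congr hL.isOpen hz fun x y _ => sq (L x y)).dx_eq]
  ring

lemma metric_symm (hz : (x, y) ∈ U) (i j : Fin n) : metric L x y i j = metric L x y j i := by
  simp only [metric, Matrix.of_apply, hL.sm_sq.dy_dy_comm hL.isOpen hz i j]

lemma dx_metric (hz : (x, y) ∈ U) (i j k : Fin n) :
    dx k (fun x y => metric L x y i j) x y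
      = 1 / 2 * dx k (dy i (dy j fun x y => L x y ^ 2)) x y :=
  ((((hL.sm_dy_sq j).dy hL.isOpen i).hasDx hL.isOpen hz k).const_mul (1 / 2)).dx_eq

lemma cartan_swap_left (hz : (x, y) ∈ U) (i j k : Fin n) :
    cartan L i j k x y = cartan L j i k x y := by
  simp only [cartan]
  rw [dy_congr hL.isOpen hz (fun x y hz => hL.metric_symm hz i j)]

/-- As a third vertical derivative of L² the Cartan tensor is totally symmetric; `cartan_swap_left`
and `cartan_swap_right` generate all permutations. -/
lemma cartan_eq (hz : (x, y) ∈ U) (i j k : Fin n) :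
    cartan L i j k x y = 1 / 4 * dy k (dy i (dy j fun x y => L x y ^ 2)) x y := by
  have h := ((((hL.sm_dy_sq j).dy hL.isOpen i).hasDy hL.isOpen hz k).const_mul (1 / 2)).dy_eq
  change 1 / 2 * dy k (fun x y => 1 / 2 * dy i (dy j fun x y => L x y ^ 2) x y) x y = _
  rw [h]
  ring

lemma cartan_swap_right (hz : (x, y) ∈ U) (i j k : Fin n) :
    cartan L i j k x y = cartan L i k j x y := by
  rw [hL.cartan_swap_left hz, hL.cartan_swap_left hz i, hL.cartan_eq hz, hL.cartan_eq hz,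
    (hL.sm_dy_sq i).dy_dy_comm hL.isOpen hz]

/-- Euler's theorem for ∂̇_i L², which has degree one. -/
lemma sum_metric_mul_coord (hz : (x, y) ∈ U) (i : Fin n) :
    ∑ j, metric L x y i j * y j = 1 / 2 * dy i (fun x y => L x y ^ 2) x y := by
  have h := Hom.euler hL.isOpen (hL.sm_dy_sq i) (hL.hom_dy_sq i) hz
  have h2 : ∀ j, metric L x y i j * y j
      = 1 / 2 * (y j * dy j (dy i fun x y => L x y ^ 2) x y) := fun j => by
    rw [hL.metric_symm hz, dy_dy_sq]
    ring
  rw [Finset.sum_congr rfl fun j _ => h2 j, ← Finset.mul_sum, h]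
  simp

lemma sum_metric_mul_coord' (hz : (x, y) ∈ U) (i : Fin n) :
    ∑ j, metric L x y i j * y j = L x y * dy i L x y := by
  rw [hL.sum_metric_mul_coord hz, hL.dy_sq hz]
  ring

lemma sum_coord_mul_dy (hz : (x, y) ∈ U) : ∑ j, y j * dy j L x y = L x y := by
  simpa using Hom.euler hL.isOpen hL.smooth hL.hom hz

lemma sum_cartan_mul_coord (hz : (x, y) ∈ U) (i j : Fin n) :
    ∑ k, cartan L i j k x y * y k = 0 := by
  have h := Hom.euler hL.isOpen (hL.sm_metric i j) (hL.hom_metric i j) hz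
  have h2 : ∀ k, cartan L i j k x y * y k
      = 1 / 2 * (y k * dy k (fun x y => metric L x y i j) x y) := fun k => by
    rw [cartan]
    ring
  rw [Finset.sum_congr rfl fun j _ => h2 j, ← Finset.mul_sum, h]
  simp

/-- The function ∂_j H has the same degree as H, so this is Euler's theorem for it after commuting
the two derivatives. -/
lemma sum_coord_mul_dx_dy {k : ℕ} {H : Coord n → Coord n → ℝ} (hs : Sm U H) (hh : Hom U k H)
    (hz : (x, y) ∈ U) (j : Fin n) : ∑ i, y i * dx j (dy i H) x y = k * dx j H x y := by
  rw [← Hom.euler hL.isOpen (hs.dx hL.isOpen j) (hh.dx hL.isOpen hs j) hz]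
  exact Finset.sum_congr rfl fun i _ => by rw [hs.dy_dx_comm hL.isOpen hz]

/-! The inverse metric. -/

lemma sum_metric_mul_metricInv (hz : (x, y) ∈ U) (w : Fin n → ℝ) (i : Fin n) :
    ∑ r, metric L x y i r * ∑ s, metricInv L x y r s * w s = w i := by
  have h := Matrix.mul_nonsing_inv (metric L x y) (hL.nondegenerate x y hz).isUnit
  have h2 : (metric L x y).mulVec ((metric L x y)⁻¹.mulVec w) = w := by
    rw [Matrix.mulVec_mulVec, h, Matrix.one_mulVec]
  exact congrFun h2 i

/-- Nondegeneracy in the form used throughout: vectors are compared after their index has been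
lowered. -/
lemma metric_cancel (hz : (x, y) ∈ U) {v w : Fin n → ℝ}
    (h : ∀ i, ∑ r, metric L x y i r * v r = ∑ r, metric L x y i r * w r) : v = w := by
  have h1 : (metric L x y).mulVec v = (metric L x y).mulVec w := funext h
  have h2 := congrArg (metric L x y)⁻¹.mulVec h1
  simpa [Matrix.mulVec_mulVec,
    Matrix.nonsing_inv_mul _ (hL.nondegenerate x y hz).isUnit] using h2

lemma metricInv_symm (hz : (x, y) ∈ U) (i j : Fin n) :
    metricInv L x y i j = metricInv L x y j i := by
  have h : (metric L x y).transpose = metric L x y := Matrix.ext fun i j => hL.metric_symm hz j i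
  have h2 : ((metric L x y)⁻¹).transpose = (metric L x y)⁻¹ := by
    rw [Matrix.transpose_nonsing_inv, h]
  exact congrFun (congrFun h2 j) i

lemma sm_metricInv (i j : Fin n) : Sm U fun x y => metricInv L x y i j :=
  Sm.matrix_inv hL.sm_metric hL.nondegenerate i j

lemma hom_metricInv (i j : Fin n) : Hom U 0 fun x y => metricInv L x y i j := by
  intro x y hz c hc
  have : metric L x (c • y) = metric L x y := Matrix.ext fun i j => by
    simpa using hL.hom_metric i j x y hz c hc
  simp [metricInv, this]

/-! The canonical spray. -/

lemma sm_christoffel (i j k : Fin n) : Sm U (christoffel L i j k) :=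
  Sm.sum fun r => ((Sm.const _).mul (hL.sm_metricInv i r)).mul
    ((((hL.sm_metric k r).dx hL.isOpen j).add ((hL.sm_metric j r).dx hL.isOpen k)).sub
      ((hL.sm_metric j k).dx hL.isOpen r))

lemma hom_christoffel (i j k : Fin n) : Hom U 0 (christoffel L i j k) := by
  intro x y hz c hc
  have h : ∀ i j k, dx k (fun x y => metric L x y i j) x (c • y)
      = dx k (fun x y => metric L x y i j) x y := fun i j k => by
    simpa using (hL.hom_metric i j).dx hL.isOpen (hL.sm_metric i j) k x y hz c hc
  have h2 : ∀ i j, metricInv L x (c • y) i j = metricInv L x y i j := fun i j => by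
    simpa using hL.hom_metricInv i j x y hz c hc
  simp [christoffel, h, h2]

lemma sm_spray (i : Fin n) : Sm U (spray L i) :=
  (Sm.const _).mul (Sm.sum fun j => Sm.sum fun k =>
    ((hL.sm_christoffel i j k).mul (Sm.coord j)).mul (Sm.coord k))

lemma hom_spray (i : Fin n) : Hom U 2 (spray L i) := by
  intro x y hz c hc
  have h : ∀ j k, christoffel L i j k x (c • y) = christoffel L i j k x y := fun j k => by
    simpa using hL.hom_christoffel i j k x y hz c hc
  simp only [spray, h, PiLp.smul_apply, smul_eq_mul, Finset.mul_sum]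
  exact Finset.sum_congr rfl fun j _ => Finset.sum_congr rfl fun k _ => by ring

lemma sum_barthel_mul_coord (hz : (x, y) ∈ U) (i : Fin n) :
    ∑ j, barthel L i j x y * y j = 2 * spray L i x y := by
  have := Hom.euler hL.isOpen (hL.sm_spray i) (hL.hom_spray i) hz
  simp only [mul_comm _ (y _)]
  exact_mod_cast this

/-- Lowering the index removes g^ir, and the two contractions with y collapse the derivatives of
g_jk to derivatives of L² by Euler's theorem. The result no longer contains the inverse metric and
can be differentiated. -/
lemma sum_metric_mul_spray (hz : (x, y) ∈ U) (i : Fin n) :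
    4 * ∑ r, metric L x y i r * spray L r x y
      = ∑ k, y k * dx k (dy i fun x y => L x y ^ 2) x y - dx i (fun x y => L x y ^ 2) x y := by
  set T : Fin n → Fin n → Fin n → ℝ := fun j k r =>
    dx j (fun x y => metric L x y k r) x y + dx k (fun x y => metric L x y j r) x y
      - dx r (fun x y => metric L x y j k) x y with hT
  have h1 : ∀ r, spray L r x y
      = ∑ s, metricInv L x y r s * (1 / 4 * ∑ j, ∑ k, T j k s * y j * y k) := by
    intro r
    simp only [spray, christoffel, Finset.mul_sum, Finset.sum_mul]
    -- The triple sum is reordered so that the index contracted with the inverse metric is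
    -- outermost.
    rw [Finset.sum_comm' (t' := Finset.univ) (s' := fun _ => Finset.univ) (by simp)]
    rw [Finset.sum_congr rfl fun k _ => Finset.sum_comm]
    rw [Finset.sum_comm]
    refine Finset.sum_congr rfl fun s _ => ?_
    rw [Finset.sum_comm]
    refine Finset.sum_congr rfl fun j _ => Finset.sum_congr rfl fun k _ => ?_
    simp only [hT]
    ring
  simp only [h1]
  rw [hL.sum_metric_mul_metricInv hz (fun s => 1 / 4 * ∑ j, ∑ k, T j k s * y j * y k)]
  have h2 : ∀ j, ∑ k, dx j (fun x y => metric L x y k i) x y * y k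
      = 1 / 2 * dx j (dy i fun x y => L x y ^ 2) x y := by
    intro j
    have := hL.sum_coord_mul_dx_dy (hL.sm_dy_sq i) (hL.hom_dy_sq i) hz j
    simp only [Nat.cast_one, one_mul] at this
    rw [← this, Finset.mul_sum]
    exact Finset.sum_congr rfl fun k _ => by rw [hL.dx_metric hz]; ring
  have h3 : ∑ j, ∑ k, dx i (fun x y => metric L x y j k) x y * y j * y k
      = dx i (fun x y => L x y ^ 2) x y := by
    have e := hL.sum_coord_mul_dx_dy hL.sm_sq hL.hom_sq hz i
    have : ∀ j, ∑ k, dx i (fun x y => metric L x y j k) x y * y j * y k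
        = 1 / 2 * (y j * dx i (dy j fun x y => L x y ^ 2) x y) := by
      intro j
      have := hL.sum_coord_mul_dx_dy (hL.sm_dy_sq j) (hL.hom_dy_sq j) hz i
      simp only [Nat.cast_one, one_mul] at this
      rw [← this, Finset.mul_sum, Finset.mul_sum]
      refine Finset.sum_congr rfl fun k _ => ?_
      rw [dx_congr hL.isOpen hz (fun x y hz => hL.metric_symm hz j k), hL.dx_metric hz]
      ring
    rw [Finset.sum_congr rfl fun j _ => this j, ← Finset.mul_sum, e]
    push_cast
    ring
  have h4 : ∑ j, ∑ k, dx j (fun x y => metric L x y k i) x y * y j * y k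
      = 1 / 2 * ∑ k, y k * dx k (dy i fun x y => L x y ^ 2) x y := by
    rw [Finset.mul_sum]
    refine Finset.sum_congr rfl fun j _ => ?_
    have := h2 j
    calc _ = y j * ∑ k, dx j (fun x y => metric L x y k i) x y * y k := by
          rw [Finset.mul_sum]
          exact Finset.sum_congr rfl fun k _ => by ring
      _ = _ := by rw [this]; ring
  -- After exchanging j and k the first two Christoffel terms coincide.
  have h5 : ∑ j, ∑ k, T j k i * y j * y k
      = (∑ j, ∑ k, dx j (fun x y => metric L x y k i) x y * y j * y k)
        + (∑ j, ∑ k, dx j (fun x y => metric L x y k i) x y * y j * y k)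
        - ∑ j, ∑ k, dx i (fun x y => metric L x y j k) x y * y j * y k := by
    conv_rhs => enter [1, 2]; rw [Finset.sum_comm]
    simp only [← Finset.sum_add_distrib, ← Finset.sum_sub_distrib]
    exact Finset.sum_congr rfl fun j _ => Finset.sum_congr rfl fun k _ => by
      simp only [hT]; ring
  rw [h5, h3, h4]
  ring

/-- This is ∂̇_j applied to `sum_metric_mul_spray`; the Cartan term appears because g_ir itself
depends on y. -/
lemma sum_metric_mul_barthel (hz : (x, y) ∈ U) (i j : Fin n) :
    4 * ∑ r, metric L x y i r * barthel L r j x y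
      = dx j (dy i fun x y => L x y ^ 2) x y - dx i (dy j fun x y => L x y ^ 2) x y
        + 2 * ∑ k, y k * dx k (fun x y => metric L x y i j) x y
        - 8 * ∑ r, cartan L i j r x y * spray L r x y := by
  have hl := (HasDir.sum (s := Finset.univ) fun r =>
    ((hL.sm_metric i r).hasDy hL.isOpen hz j).mul ((hL.sm_spray r).hasDy hL.isOpen hz j)).const_mul 4
  have hr := (HasDir.sum (s := Finset.univ) fun k =>
    (HasDir.coord (x := x) (y := y) (v := vy j) k).mul
      (((hL.sm_dy_sq i).dx hL.isOpen k).hasDy hL.isOpen hz j)).sub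
    ((hL.sm_sq.dx hL.isOpen i).hasDy hL.isOpen hz j)
  have h := hl.unique (hr.congr hL.isOpen hz fun x y hz => hL.sum_metric_mul_spray hz i)
  rw [Finset.sum_add_distrib, Finset.sum_add_distrib, sum_vy_mul j,
    hL.sm_sq.dy_dx_comm hL.isOpen hz] at h
  have e1 : ∑ r, dy j (fun x y => metric L x y i r) x y * spray L r x y
      = 2 * ∑ r, cartan L i j r x y * spray L r x y := by
    rw [Finset.mul_sum]
    refine Finset.sum_congr rfl fun r _ => ?_
    rw [dy_metric, hL.cartan_swap_right hz]
    ring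
  have e2 : ∑ k, y k * dy j (dx k (dy i fun x y => L x y ^ 2)) x y
      = 2 * ∑ k, y k * dx k (fun x y => metric L x y i j) x y := by
    rw [Finset.mul_sum]
    refine Finset.sum_congr rfl fun k _ => ?_
    rw [dx_congr hL.isOpen hz (fun x y hz => hL.metric_symm hz i j), hL.dx_metric hz,
      (hL.sm_dy_sq i).dy_dx_comm hL.isOpen hz]
    ring
  rw [e1, e2] at h
  simp only [barthel]
  linear_combination h

/-- The fundamental function is horizontally constant. -/
lemma dx_sq_eq (hz : (x, y) ∈ U) (j : Fin n) :
    dx j (fun x y => L x y ^ 2) x y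
      = ∑ r, barthel L r j x y * dy r (fun x y => L x y ^ 2) x y := by
  -- Contraction of the lowered Barthel connection with y^i: the Cartan term vanishes, the second
  -- and third terms cancel, and only 2 ∂_j L² remains.
  have h : ∑ i, y i * (4 * ∑ r, metric L x y i r * barthel L r j x y) = ∑ i, y i * _ :=
    Finset.sum_congr rfl fun i _ => by rw [hL.sum_metric_mul_barthel hz i j]
  have e0 : ∑ i, y i * (4 * ∑ r, metric L x y i r * barthel L r j x y)
      = 2 * ∑ r, barthel L r j x y * dy r (fun x y => L x y ^ 2) x y := by
    simp only [Finset.mul_sum]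
    rw [Finset.sum_comm]
    refine Finset.sum_congr rfl fun r _ => ?_
    have := hL.sum_metric_mul_coord hz r
    calc _ = 4 * barthel L r j x y * ∑ i, metric L x y r i * y i := by
          rw [Finset.mul_sum]
          exact Finset.sum_congr rfl fun i _ => by rw [hL.metric_symm hz r i]; ring
      _ = _ := by rw [this]; ring
  have e1 := hL.sum_coord_mul_dx_dy hL.sm_sq hL.hom_sq hz j
  have e2 : ∑ i, y i * (2 * ∑ k, y k * dx k (fun x y => metric L x y i j) x y)
      = ∑ k, y k * dx k (dy j fun x y => L x y ^ 2) x y := by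
    simp only [Finset.mul_sum]
    rw [Finset.sum_comm]
    refine Finset.sum_congr rfl fun k _ => ?_
    have := hL.sum_coord_mul_dx_dy (hL.sm_dy_sq j) (hL.hom_dy_sq j) hz k
    simp only [Nat.cast_one, one_mul] at this
    rw [← this, Finset.mul_sum]
    exact Finset.sum_congr rfl fun i _ => by rw [hL.dx_metric hz]; ring
  have e3 : ∑ i, y i * (8 * ∑ r, cartan L i j r x y * spray L r x y) = 0 := by
    simp only [Finset.mul_sum]
    rw [Finset.sum_comm]
    refine Finset.sum_eq_zero fun r _ => ?_
    have := hL.sum_cartan_mul_coord hz j r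
    calc _ = 8 * spray L r x y * ∑ i, cartan L j r i x y * y i := by
          rw [Finset.mul_sum]
          exact Finset.sum_congr rfl fun i _ => by
            rw [hL.cartan_swap_left hz, hL.cartan_swap_right hz j]; ring
      _ = _ := by rw [this]; ring
  simp only [mul_add, mul_sub, Finset.sum_add_distrib, Finset.sum_sub_distrib] at h
  rw [e0, e1, e2, e3] at h
  push_cast at h
  linear_combination -1 / 2 * h

lemma dx_eq (hz : (x, y) ∈ U) (j : Fin n) :
    dx j L x y = ∑ r, barthel L r j x y * dy r L x y := by
  have h := hL.dx_sq_eq hz j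
  rw [hL.dx_sq hz, Finset.sum_congr rfl fun r _ => by rw [hL.dy_sq hz r]] at h
  have h0 : 2 * L x y ≠ 0 := by have := hL.pos x y hz; positivity
  refine mul_left_cancel₀ h0 ?_
  rw [h, Finset.mul_sum]
  exact Finset.sum_congr rfl fun r _ => by ring

lemma cartanGamma_symm (hz : (x, y) ∈ U) (i j k : Fin n) :
    cartanGamma L i j k x y = cartanGamma L i k j x y := by
  simp only [cartanGamma]
  refine Finset.sum_congr rfl fun r _ => ?_
  have : hder L r (fun x y => metric L x y j k) x y = hder L r (fun x y => metric L x y k j) x y := by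
    simp only [hder]
    rw [dx_congr hL.isOpen hz fun x y hz => hL.metric_symm hz j k]
    congr 1
    exact Finset.sum_congr rfl fun s _ => by
      rw [dy_congr hL.isOpen hz fun x y hz => hL.metric_symm hz j k]
  rw [this]
  ring

/-- The vertical part of δ_j contributes nothing, because the Cartan tensor contracted with y is
zero. -/
lemma sum_coord_mul_hder (hz : (x, y) ∈ U) (i j : Fin n) :
    ∑ k, y k * hder L j (fun x y => metric L x y k i) x y
      = 1 / 2 * dx j (dy i fun x y => L x y ^ 2) x y := by
  have e1 := hL.sum_coord_mul_dx_dy (hL.sm_dy_sq i) (hL.hom_dy_sq i) hz j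
  have e2 : ∑ k, y k * ∑ r, barthel L r j x y * dy r (fun x y => metric L x y k i) x y = 0 := by
    simp only [Finset.mul_sum]
    rw [Finset.sum_comm]
    refine Finset.sum_eq_zero fun r _ => ?_
    have := hL.sum_cartan_mul_coord hz i r
    calc _ = 2 * barthel L r j x y * ∑ k, cartan L i r k x y * y k := by
          rw [Finset.mul_sum]
          exact Finset.sum_congr rfl fun k _ => by
            rw [dy_metric, hL.cartan_swap_left hz, hL.cartan_swap_right hz i]; ring
      _ = _ := by rw [this]; ring
  simp only [hder, mul_sub, Finset.sum_sub_distrib]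
  rw [e2, Finset.sum_congr rfl fun k _ => by rw [hL.dx_metric hz]]
  simp only [Nat.cast_one, one_mul] at e1
  rw [← e1, Finset.mul_sum, sub_zero]
  exact Finset.sum_congr rfl fun k _ => by ring

/-- With the index lowered, two of the three terms reduce to x-derivatives by `sum_coord_mul_hder`;
in the term y^k δ_k g_jl the contraction N^r_k y^k = 2G^r supplies exactly the Cartan term of
`sum_metric_mul_barthel`. -/
lemma sum_cartanGamma_mul_coord (hz : (x, y) ∈ U) (i j : Fin n) :
    ∑ k, cartanGamma L i j k x y * y k = barthel L i j x y := by
  set T : Fin n → Fin n → ℝ := fun k r =>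
    hder L j (fun x y => metric L x y k r) x y + hder L k (fun x y => metric L x y j r) x y
      - hder L r (fun x y => metric L x y j k) x y with hT
  have h1 : ∀ i, ∑ k, cartanGamma L i j k x y * y k
      = ∑ s, metricInv L x y i s * (1 / 2 * ∑ k, y k * T k s) := by
    intro i
    simp only [cartanGamma, Finset.mul_sum, Finset.sum_mul]
    rw [Finset.sum_comm]
    refine Finset.sum_congr rfl fun s _ => Finset.sum_congr rfl fun k _ => ?_
    simp only [hT]
    ring
  refine congrFun (hL.metric_cancel hz (v := fun i => ∑ k, cartanGamma L i j k x y * y k)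
    (w := fun i => barthel L i j x y) fun l => ?_) i
  simp only [h1]
  rw [hL.sum_metric_mul_metricInv hz (fun s => 1 / 2 * ∑ k, y k * T k s)]
  have e1 := hL.sum_coord_mul_hder hz l j
  have e2 := hL.sum_coord_mul_hder hz j l
  have e2' : ∑ k, y k * hder L l (fun x y => metric L x y j k) x y
      = ∑ k, y k * hder L l (fun x y => metric L x y k j) x y := by
    refine Finset.sum_congr rfl fun k _ => ?_
    simp only [hder]
    rw [dx_congr hL.isOpen hz fun x y hz => hL.metric_symm hz j k]
    congr 2
    exact Finset.sum_congr rfl fun s _ => by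
      rw [dy_congr hL.isOpen hz fun x y hz => hL.metric_symm hz j k]
  have e3 : ∑ k, y k * hder L k (fun x y => metric L x y j l) x y
      = ∑ k, y k * dx k (fun x y => metric L x y l j) x y
        - 4 * ∑ r, cartan L l j r x y * spray L r x y := by
    simp only [hder, mul_sub, Finset.sum_sub_distrib]
    congr 1
    · exact Finset.sum_congr rfl fun k _ => by
        rw [dx_congr hL.isOpen hz fun x y hz => hL.metric_symm hz j l]
    · simp only [Finset.mul_sum]
      rw [Finset.sum_comm]
      refine Finset.sum_congr rfl fun r _ => ?_
      calc _ = 2 * cartan L l j r x y * ∑ k, barthel L r k x y * y k := by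
            rw [Finset.mul_sum]
            exact Finset.sum_congr rfl fun k _ => by
              rw [dy_metric, hL.cartan_swap_left hz]; ring
        _ = _ := by rw [hL.sum_barthel_mul_coord hz]; ring
  have e4 := hL.sum_metric_mul_barthel hz l j
  simp only [hT, mul_add, mul_sub, Finset.sum_add_distrib, Finset.sum_sub_distrib]
  rw [e2', e1, e2, e3]
  linear_combination -1 / 4 * e4

end IsLocalFinsler

end LocalFinsler

/-! ### Functions of two real variables -/

section Plane

variable {Ω : Set (ℝ × ℝ)} {u u' : ℝ → ℝ → ℝ} {s t : ℝ}

/-- `u` is smooth on `Ω`. -/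
def SmP (Ω : Set (ℝ × ℝ)) (u : ℝ → ℝ → ℝ) : Prop :=
  ContDiffOn ℝ ∞ (fun w : ℝ × ℝ => u w.1 w.2) Ω

/-- Euler's identity of degree `k` for `u` on `Ω`. -/
def EulerP (Ω : Set (ℝ × ℝ)) (k : ℝ) (u : ℝ → ℝ → ℝ) : Prop :=
  ∀ s t, (s, t) ∈ Ω → s * pd1 u s t + t * pd2 u s t = k * u s t

namespace SmP

lemma differentiableAt (hΩ : IsOpen Ω) (h : SmP Ω u) (hw : (s, t) ∈ Ω) :
    DifferentiableAt ℝ (fun w : ℝ × ℝ => u w.1 w.2) (s, t) :=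
  (h.contDiffAt (hΩ.mem_nhds hw)).differentiableAt (by simp)

lemma hasDerivAt_left (hΩ : IsOpen Ω) (h : SmP Ω u) (hw : (s, t) ∈ Ω) :
    HasDerivAt (fun r => u r t) (pd1 u s t) s := by
  have := (h.differentiableAt hΩ hw).comp s
    (hasFDerivAt_prodMk_left (𝕜 := ℝ) s t).differentiableAt
  exact this.hasDerivAt

lemma hasDerivAt_right (hΩ : IsOpen Ω) (h : SmP Ω u) (hw : (s, t) ∈ Ω) :
    HasDerivAt (fun r => u s r) (pd2 u s t) t := by
  have := (h.differentiableAt hΩ hw).comp t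
    (hasFDerivAt_prodMk_right (𝕜 := ℝ) s t).differentiableAt
  exact this.hasDerivAt

lemma pd1_eq (hΩ : IsOpen Ω) (h : SmP Ω u) (hw : (s, t) ∈ Ω) :
    pd1 u s t = fderiv ℝ (fun w : ℝ × ℝ => u w.1 w.2) (s, t) (1, 0) := by
  have := ((h.differentiableAt hΩ hw).hasFDerivAt.comp s
    (hasFDerivAt_prodMk_left (𝕜 := ℝ) s t)).hasDerivAt.deriv
  simpa [pd1, Function.comp_def] using this

lemma pd2_eq (hΩ : IsOpen Ω) (h : SmP Ω u) (hw : (s, t) ∈ Ω) :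
    pd2 u s t = fderiv ℝ (fun w : ℝ × ℝ => u w.1 w.2) (s, t) (0, 1) := by
  have := ((h.differentiableAt hΩ hw).hasFDerivAt.comp t
    (hasFDerivAt_prodMk_right (𝕜 := ℝ) s t)).hasDerivAt.deriv
  simpa [pd2, Function.comp_def] using this

lemma fderiv (hΩ : IsOpen Ω) (h : SmP Ω u) :
    ContDiffOn ℝ ∞ (fderiv ℝ (fun w : ℝ × ℝ => u w.1 w.2)) Ω :=
  h.fderiv_of_isOpen hΩ (by simp)

lemma pd1 (hΩ : IsOpen Ω) (h : SmP Ω u) : SmP Ω (pd1 u) :=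
  ((h.fderiv hΩ).clm_apply contDiffOn_const).congr fun _ hw => h.pd1_eq hΩ hw

lemma pd2 (hΩ : IsOpen Ω) (h : SmP Ω u) : SmP Ω (pd2 u) :=
  ((h.fderiv hΩ).clm_apply contDiffOn_const).congr fun _ hw => h.pd2_eq hΩ hw

lemma add (h : SmP Ω u) (h' : SmP Ω u') : SmP Ω (fun s t => u s t + u' s t) :=
  ContDiffOn.add h h'

lemma mul (h : SmP Ω u) (h' : SmP Ω u') : SmP Ω (fun s t => u s t * u' s t) :=
  ContDiffOn.mul h h'

lemma pow (h : SmP Ω u) (k : ℕ) : SmP Ω (fun s t => u s t ^ k) := ContDiffOn.pow h k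

end SmP

lemma pd1_congr (hΩ : IsOpen Ω) (hw : (s, t) ∈ Ω) (e : ∀ s t, (s, t) ∈ Ω → u s t = u' s t) :
    pd1 u s t = pd1 u' s t := by
  have : (fun r => u r t) =ᶠ[nhds s] fun r => u' r t := by
    have hc : ContinuousAt (fun r : ℝ => (r, t)) s := by fun_prop
    filter_upwards [hc.preimage_mem_nhds (hΩ.mem_nhds hw)] with r hr using e _ _ hr
  rw [pd1, pd1, this.deriv_eq]

lemma pd2_congr (hΩ : IsOpen Ω) (hw : (s, t) ∈ Ω) (e : ∀ s t, (s, t) ∈ Ω → u s t = u' s t) :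
    pd2 u s t = pd2 u' s t := by
  have : (fun r => u s r) =ᶠ[nhds t] fun r => u' s r := by
    have hc : ContinuousAt (fun r : ℝ => (s, r)) t := by fun_prop
    filter_upwards [hc.preimage_mem_nhds (hΩ.mem_nhds hw)] with r hr using e _ _ hr
  rw [pd2, pd2, this.deriv_eq]

lemma SmP.pd1_pd2_comm (hΩ : IsOpen Ω) (h : SmP Ω u) (hw : (s, t) ∈ Ω) :
    BetaConformal.pd1 (BetaConformal.pd2 u) s t = BetaConformal.pd2 (BetaConformal.pd1 u) s t := by
  have hd := (((h.fderiv hΩ).contDiffAt (hΩ.mem_nhds hw)).differentiableAt (by simp)).hasFDerivAt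
  have h1 := ((hd.clm_apply (hasFDerivAt_const ((0 : ℝ), (1 : ℝ)) (s, t))).comp s
    (hasFDerivAt_prodMk_left (𝕜 := ℝ) s t)).hasDerivAt.deriv
  have h2 := ((hd.clm_apply (hasFDerivAt_const ((1 : ℝ), (0 : ℝ)) (s, t))).comp t
    (hasFDerivAt_prodMk_right (𝕜 := ℝ) s t)).hasDerivAt.deriv
  rw [pd1_congr hΩ hw (fun s t hw => h.pd2_eq hΩ hw),
    pd2_congr hΩ hw (fun s t hw => h.pd1_eq hΩ hw)]
  simp only [Function.comp_def] at h1 h2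
  rw [BetaConformal.pd1, BetaConformal.pd2, h1, h2]
  have hs := (h.contDiffAt (hΩ.mem_nhds hw)).isSymmSndFDerivAt
    (by simp only [minSmoothness_of_isRCLikeNormedField]; exact ENat.LEInfty.out)
    ((1 : ℝ), (0 : ℝ)) ((0 : ℝ), (1 : ℝ))
  simpa using hs

/-- Differentiating s u_1 + t u_2 = k u in s leaves one extra u_1, which lowers the degree by one.
-/
lemma EulerP.pd1 {k : ℝ} (hΩ : IsOpen Ω) (h : SmP Ω u) (hk : EulerP Ω k u) :
    EulerP Ω (k - 1) (pd1 u) := by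
  intro s t hw
  have h1 := ((hasDerivAt_id s).mul ((h.pd1 hΩ).hasDerivAt_left hΩ hw)).add
    (((h.pd2 hΩ).hasDerivAt_left hΩ hw).const_mul t)
  have h2 := (h.hasDerivAt_left hΩ hw).const_mul k
  have e := pd1_congr (u := fun s t => s * BetaConformal.pd1 u s t + t * BetaConformal.pd2 u s t)
    (u' := fun s t => k * u s t) hΩ hw hk
  have e1 : BetaConformal.pd1 (fun s t => s * BetaConformal.pd1 u s t + t * BetaConformal.pd2 u s t)
    s t = _ := h1.deriv
  have e2 : BetaConformal.pd1 (fun s t => k * u s t) s t = _ := h2.deriv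
  rw [e1, e2, h.pd1_pd2_comm hΩ hw] at e
  simp only [id] at e
  linear_combination e

lemma EulerP.pd2 {k : ℝ} (hΩ : IsOpen Ω) (h : SmP Ω u) (hk : EulerP Ω k u) :
    EulerP Ω (k - 1) (pd2 u) := by
  intro s t hw
  have h1 := (((h.pd1 hΩ).hasDerivAt_right hΩ hw).const_mul s).add
    ((hasDerivAt_id t).mul ((h.pd2 hΩ).hasDerivAt_right hΩ hw))
  have h2 := (h.hasDerivAt_right hΩ hw).const_mul k
  have e := pd2_congr (u := fun s t => s * BetaConformal.pd1 u s t + t * BetaConformal.pd2 u s t)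
    (u' := fun s t => k * u s t) hΩ hw hk
  have e1 : BetaConformal.pd2 (fun s t => s * BetaConformal.pd1 u s t + t * BetaConformal.pd2 u s t)
    s t = _ := h1.deriv
  have e2 : BetaConformal.pd2 (fun s t => k * u s t) s t = _ := h2.deriv
  rw [e1, e2] at e
  rw [h.pd1_pd2_comm hΩ hw]
  simp only [id] at e
  linear_combination e

lemma pd1_mul (hΩ : IsOpen Ω) (h : SmP Ω u) (h' : SmP Ω u') (hw : (s, t) ∈ Ω) :
    pd1 (fun s t => u s t * u' s t) s t = pd1 u s t * u' s t + u s t * pd1 u' s t :=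
  ((h.hasDerivAt_left hΩ hw).mul (h'.hasDerivAt_left hΩ hw)).deriv

lemma pd2_mul (hΩ : IsOpen Ω) (h : SmP Ω u) (h' : SmP Ω u') (hw : (s, t) ∈ Ω) :
    pd2 (fun s t => u s t * u' s t) s t = pd2 u s t * u' s t + u s t * pd2 u' s t :=
  ((h.hasDerivAt_right hΩ hw).mul (h'.hasDerivAt_right hΩ hw)).deriv

lemma EulerP.mul {k k' : ℝ} (hΩ : IsOpen Ω) (h : SmP Ω u) (h' : SmP Ω u') (hk : EulerP Ω k u)
    (hk' : EulerP Ω k' u') : EulerP Ω (k + k') (fun s t => u s t * u' s t) := by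
  intro s t hw
  rw [pd1_mul hΩ h h' hw, pd2_mul hΩ h h' hw]
  linear_combination u' s t * hk s t hw + u s t * hk' s t hw

lemma EulerP.congr {k : ℝ} (hΩ : IsOpen Ω) (h : EulerP Ω k u)
    (e : ∀ s t, (s, t) ∈ Ω → u' s t = u s t) : EulerP Ω k u' := by
  intro s t hw
  rw [pd1_congr hΩ hw e, pd2_congr hΩ hw e, e s t hw, h s t hw]

lemma IsHomogeneousOn.euler (hf : IsHomogeneousOn Ω u) : EulerP Ω 1 u := by
  intro s t hw
  have hs : SmP Ω u := hf.smooth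
  have h1 : HasDerivAt (fun c : ℝ => u (c * s) (c * t))
      (_root_.fderiv ℝ (fun w : ℝ × ℝ => u w.1 w.2) (s, t) (s, t)) 1 := by
    have hc : HasDerivAt (fun c : ℝ => (c * s, c * t)) (s, t) 1 := by
      simpa using ((hasDerivAt_id (1 : ℝ)).mul_const s).prodMk
        ((hasDerivAt_id (1 : ℝ)).mul_const t)
    have hF := (hs.differentiableAt hf.isOpen hw).hasFDerivAt
    have e : (s, t) = ((fun c : ℝ => (c * s, c * t)) 1) := by simp
    rw [e] at hF
    refine (hF.comp_hasDerivAt (1 : ℝ) hc).congr_deriv ?_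
    simp
  have h2 : HasDerivAt (fun c : ℝ => c * u s t) (u s t) 1 := by
    simpa using (hasDerivAt_id (1 : ℝ)).mul_const (u s t)
  have h3 : (fun c : ℝ => c * u s t) =ᶠ[nhds 1] fun c : ℝ => u (c * s) (c * t) := by
    filter_upwards [lt_mem_nhds (zero_lt_one (α := ℝ))] with c hc
      using (hf.homogeneous (s, t) hw c hc).symm
  rw [one_mul, ← (h1.congr_of_eventuallyEq h3).unique h2, hs.pd1_eq hf.isOpen hw,
    hs.pd2_eq hf.isOpen hw]
  have : ((s, t) : ℝ × ℝ) = s • ((1 : ℝ), (0 : ℝ)) + t • ((0 : ℝ), (1 : ℝ)) := by simp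
  conv_rhs => arg 2; rw [this]
  rw [map_add, map_smul, map_smul, smul_eq_mul, smul_eq_mul]

end Plane

section Change

/-! ### Generalized `β`-conformal changes in coordinates -/

/-- The coordinate data of a generalized `β`-conformal change between two Finsler structures over
the open conic set `U`. -/
structure IsLocalChange (c : ChangeData n) (U : Set (Coord n × Coord n)) (Ω : Set (ℝ × ℝ)) :
    Prop where
  base : IsLocalFinsler U c.L
  changed : IsLocalFinsler U c.fv
  smooth_σ : Sm U fun x _ => c.σ x
  smooth_b : ∀ i, Sm U fun x _ => c.b i x
  hom_f : IsHomogeneousOn Ω c.f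
  mem : ∀ x y, (x, y) ∈ U → (c.Lt x y, c.β x y) ∈ Ω

variable {c : ChangeData n} {U : Set (Coord n × Coord n)} {Ω : Set (ℝ × ℝ)} {x y : Coord n}

lemma HasDir.of_fst {φ : Coord n → ℝ} (hU : IsOpen U) (h : Sm U fun x _ => φ x) (hz : (x, y) ∈ U)
    (j : Fin n) : HasDir (fun x _ => φ x) x y (vy j) 0 :=
  (h.hasDy hU hz j).congr_val (by simp [dy])

namespace IsLocalChange

variable (hc : IsLocalChange c U Ω)
include hc

lemma isOpen : IsOpen U := hc.base.isOpen

lemma smP : SmP Ω c.f := hc.hom_f.smooth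

lemma L_pos (hz : (x, y) ∈ U) : 0 < c.L x y := hc.base.pos x y hz

lemma fv_pos (hz : (x, y) ∈ U) : 0 < c.fv x y := hc.changed.pos x y hz

lemma hasDy_b (hz : (x, y) ∈ U) (i j : Fin n) : HasDir (fun x _ => c.b i x) x y (vy j) 0 :=
  HasDir.of_fst hc.isOpen (hc.smooth_b i) hz j

lemma hasDy_es (hz : (x, y) ∈ U) (j : Fin n) : HasDir (fun x _ => c.es x) x y (vy j) 0 :=
  HasDir.of_fst hc.isOpen hc.smooth_σ.exp hz j

lemma hasDy_Lt (hz : (x, y) ∈ U) (j : Fin n) :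
    HasDir c.Lt x y (vy j) (c.es x * dy j c.L x y) :=
  ((hc.hasDy_es hz j).mul (hc.base.smooth.hasDy hc.isOpen hz j)).congr_val (by ring)

lemma hasDy_β (hz : (x, y) ∈ U) (j : Fin n) : HasDir c.β x y (vy j) (c.b j x) := by
  refine (HasDir.sum fun i => (hc.hasDy_b hz i j).mul (HasDir.coord i)).congr_val ?_
  simp only [zero_mul, zero_add]
  rw [← sum_vy_mul j fun i => c.b i x]
  exact Finset.sum_congr rfl fun i _ => mul_comm _ _

lemma yl_eq (hz : (x, y) ∈ U) (i : Fin n) : c.yl i x y = c.L x y * dy i c.L x y :=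
  hc.base.sum_metric_mul_coord' hz i

lemma dy_L_eq (hz : (x, y) ∈ U) (i : Fin n) : dy i c.L x y = c.yl i x y / c.L x y := by
  rw [hc.yl_eq hz]
  field_simp [(hc.L_pos hz).ne']

lemma hasDy_L (hz : (x, y) ∈ U) (i : Fin n) : HasDir c.L x y (vy i) (c.yl i x y / c.L x y) :=
  (hc.base.smooth.hasDy hc.isOpen hz i).congr_val (hc.dy_L_eq hz i)

lemma h_eq (hz : (x, y) ∈ U) (i j : Fin n) :
    c.h i j x y = c.g x y i j - c.yl i x y * c.yl j x y / c.L x y ^ 2 := by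
  rw [ChangeData.h, hc.dy_L_eq hz, hc.dy_L_eq hz]
  have := (hc.L_pos hz).ne'
  field_simp

/-- Because y_i = ½ ∂̇_i L², the y-dependence of g_ij adds no term. -/
lemma hasDy_yl (hz : (x, y) ∈ U) (i j : Fin n) :
    HasDir (c.yl i) x y (vy j) (c.g x y i j) := by
  refine (((hc.base.sm_dy_sq i).hasDy hc.isOpen hz j).const_mul (1 / 2)).congr hc.isOpen hz
    (fun x y hz => hc.base.sum_metric_mul_coord hz i) |>.congr_val ?_
  rw [dy_dy_sq, hc.base.metric_symm hz, ChangeData.g]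
  ring

lemma hasDy_comp_one {u : ℝ → ℝ → ℝ} (hu : SmP Ω u) (hz : (x, y) ∈ U) (j : Fin n) :
    HasDir (fun x y => u (c.Lt x y) (c.β x y)) x y (vy j)
      (pd1 u (c.Lt x y) (c.β x y) * (c.es x * (c.yl j x y / c.L x y))
        + pd2 u (c.Lt x y) (c.β x y) * c.b j x) := by
  rw [← hc.dy_L_eq hz]
  exact HasDir.comp₂ (hu.differentiableAt hc.hom_f.isOpen (hc.mem x y hz)) (hc.hasDy_Lt hz j)
    (hc.hasDy_β hz j)

/-- In degree zero Euler's identity expresses u_1 through u_2, and the two terms of the chain rule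
merge into a multiple of m_j. This is how the covector m_j enters the theory. -/
lemma hasDy_comp_zero {u : ℝ → ℝ → ℝ} (hu : SmP Ω u) (h0 : EulerP Ω 0 u) (hz : (x, y) ∈ U)
    (j : Fin n) :
    HasDir (fun x y => u (c.Lt x y) (c.β x y)) x y (vy j)
      (pd2 u (c.Lt x y) (c.β x y) * c.m j x y) := by
  refine (hc.hasDy_comp_one hu hz j).congr_val ?_
  have e := h0 _ _ (hc.mem x y hz)
  have hL := (hc.L_pos hz).ne'
  rw [ChangeData.m]
  have e2 : c.Lt x y = c.es x * c.L x y := rfl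
  have e3 : c.es x * c.L x y * pd1 u (c.Lt x y) (c.β x y)
      = -(c.β x y * pd2 u (c.Lt x y) (c.β x y)) := by rw [← e2]; linear_combination e
  field_simp
  linear_combination c.yl j x y * e3

/-! The partial derivatives of `q = f f_2` and of `f f_1`. -/

lemma smP_q : SmP Ω fun s t => c.f s t * pd2 c.f s t := hc.smP.mul (hc.smP.pd2 hc.hom_f.isOpen)

lemma eulerP_q : EulerP Ω 1 fun s t => c.f s t * pd2 c.f s t := by
  have := hc.hom_f.euler.mul hc.hom_f.isOpen hc.smP (hc.smP.pd2 hc.hom_f.isOpen)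
    (hc.hom_f.euler.pd2 hc.hom_f.isOpen hc.smP)
  norm_num at this
  exact this

lemma smP_ff1 : SmP Ω fun s t => c.f s t * pd1 c.f s t := hc.smP.mul (hc.smP.pd1 hc.hom_f.isOpen)

lemma eulerP_ff1 : EulerP Ω 1 fun s t => c.f s t * pd1 c.f s t := by
  have := hc.hom_f.euler.mul hc.hom_f.isOpen hc.smP (hc.smP.pd1 hc.hom_f.isOpen)
    (hc.hom_f.euler.pd1 hc.hom_f.isOpen hc.smP)
  norm_num at this
  exact this

lemma pd2_q {s t : ℝ} (hw : (s, t) ∈ Ω) : pd2 (fun s t => c.f s t * pd2 c.f s t) s t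
    = pd2 c.f s t ^ 2 + c.f s t * pd2 (pd2 c.f) s t := by
  rw [pd2_mul hc.hom_f.isOpen hc.smP (hc.smP.pd2 hc.hom_f.isOpen) hw]
  ring

lemma pd1_q {s t : ℝ} (hw : (s, t) ∈ Ω) : pd1 (fun s t => c.f s t * pd2 c.f s t) s t
    = pd1 c.f s t * pd2 c.f s t + c.f s t * pd2 (pd1 c.f) s t := by
  rw [pd1_mul hc.hom_f.isOpen hc.smP (hc.smP.pd2 hc.hom_f.isOpen) hw,
    hc.smP.pd1_pd2_comm hc.hom_f.isOpen hw]

/-- Both sides are half the mixed second derivative of f². Hence the single scalar p_{-1} governs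
the derivatives of both p and q. -/
lemma pd2_ff1 {s t : ℝ} (hw : (s, t) ∈ Ω) : pd2 (fun s t => c.f s t * pd1 c.f s t) s t
    = pd1 (fun s t => c.f s t * pd2 c.f s t) s t := by
  rw [pd2_mul hc.hom_f.isOpen hc.smP (hc.smP.pd1 hc.hom_f.isOpen) hw, hc.pd1_q hw]
  ring

lemma pm1_eq (hz : (x, y) ∈ U) : c.pm1 x y
    = pd1 (fun s t => c.f s t * pd2 c.f s t) (c.Lt x y) (c.β x y) / c.L x y := by
  rw [hc.pd1_q (hc.mem x y hz)]
  have h1 := (hc.L_pos hz).ne'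
  have h2 := (hc.fv_pos hz).ne'
  rw [ChangeData.pm1, ChangeData.qm1, ChangeData.p]
  field_simp
  rw [ChangeData.fv, ChangeData.f1, ChangeData.f2, ChangeData.f12]
  ring

lemma p0_eq (hz : (x, y) ∈ U) : c.p0 x y
    = pd2 (fun s t => c.f s t * pd2 c.f s t) (c.Lt x y) (c.β x y) :=
  (hc.pd2_q (hc.mem x y hz)).symm

/-- Euler's identity for q = f f_2, whose partial derivatives are L p_{-1} and p_0. With `fv_sq_eq`
and `q0_eq` it reduces the later scalar identities to polynomial algebra. -/
lemma q_eq (hz : (x, y) ∈ U) :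
    c.q x y = c.es x * c.L x y ^ 2 * c.pm1 x y + c.β x y * c.p0 x y := by
  have e := hc.eulerP_q _ _ (hc.mem x y hz)
  have h1 := (hc.L_pos hz).ne'
  rw [hc.pm1_eq hz, hc.p0_eq hz]
  have e2 : c.Lt x y = c.es x * c.L x y := rfl
  rw [ChangeData.q]
  field_simp
  rw [ChangeData.fv, ChangeData.f2]
  linear_combination -e + pd1 (fun s t => c.f s t * pd2 c.f s t) (c.Lt x y) (c.β x y) * e2

lemma fv_sq_eq (hz : (x, y) ∈ U) :
    c.fv x y ^ 2 = c.es x * c.p x y * c.L x y ^ 2 + c.q x y * c.β x y := by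
  have e := hc.hom_f.euler _ _ (hc.mem x y hz)
  have h1 := (hc.L_pos hz).ne'
  have e2 : c.Lt x y = c.es x * c.L x y := rfl
  rw [ChangeData.q, ChangeData.p]
  field_simp
  rw [ChangeData.fv, ChangeData.f2, ChangeData.f1]
  linear_combination -c.f (c.Lt x y) (c.β x y) * e
    + c.f (c.Lt x y) (c.β x y) * pd1 c.f (c.Lt x y) (c.β x y) * e2

lemma q0_eq (hz : (x, y) ∈ U) : c.q0 x y = c.p0 x y - c.q x y ^ 2 / c.fv x y ^ 2 := by
  have h2 := (hc.fv_pos hz).ne'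
  rw [ChangeData.p0, ChangeData.q]
  field_simp
  ring

lemma hasDy_q (hz : (x, y) ∈ U) (j : Fin n) : HasDir c.q x y (vy j) (c.Q j x y) := by
  refine (hc.hasDy_comp_one hc.smP_q hz j).congr_val ?_
  rw [ChangeData.Q, hc.pm1_eq hz, hc.p0_eq hz]
  ring

lemma hasDy_p (hz : (x, y) ∈ U) (j : Fin n) :
    HasDir c.p x y (vy j) (c.pm1 x y * c.m j x y) := by
  have h1 := (hc.L_pos hz).ne'
  refine ((hc.hasDy_comp_one hc.smP_ff1 hz j).mul ((hc.hasDy_L hz j).inv h1)).congr_val ?_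
  have e := hc.eulerP_ff1 _ _ (hc.mem x y hz)
  rw [hc.pd2_ff1 (hc.mem x y hz)] at e ⊢
  rw [hc.pm1_eq hz, ChangeData.m]
  have e2 : c.Lt x y = c.es x * c.L x y := rfl
  generalize pd1 (fun s t => c.f s t * pd2 c.f s t) (c.Lt x y) (c.β x y) = R at *
  generalize pd1 (fun s t => c.f s t * pd1 c.f s t) (c.Lt x y) (c.β x y) = Z at *
  field_simp
  linear_combination c.yl j x y * e - c.yl j x y * Z * e2

lemma hasDy_p0 (hz : (x, y) ∈ U) (j : Fin n) :
    HasDir c.p0 x y (vy j) (c.p02 x y * c.m j x y) := by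
  have hΩ := hc.hom_f.isOpen
  have hs : SmP Ω fun s t => pd2 c.f s t ^ 2 + c.f s t * pd2 (pd2 c.f) s t :=
    ((hc.smP.pd2 hΩ).pow 2).add (hc.smP.mul ((hc.smP.pd2 hΩ).pd2 hΩ))
  have he : EulerP Ω 0 fun s t => pd2 c.f s t ^ 2 + c.f s t * pd2 (pd2 c.f) s t := by
    have := (hc.eulerP_q.pd2 hΩ hc.smP_q).congr hΩ fun s t hw => (hc.pd2_q hw).symm
    rwa [sub_self] at this
  exact hc.hasDy_comp_zero hs he hz j

/-- L p_{-1} is the first partial derivative of q, of degree zero, so its derivative is a multiple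
of m_j; Euler's identity for the second partial derivative of q turns the coefficient into p_02. The
last term comes from the factor 1/L. -/
lemma hasDy_pm1 (hz : (x, y) ∈ U) (j : Fin n) :
    HasDir c.pm1 x y (vy j)
      (-(c.β x y * c.p02 x y * c.m j x y) / (c.es x * c.L x y ^ 2)
        - c.pm1 x y * c.yl j x y / c.L x y ^ 2) := by
  have hΩ := hc.hom_f.isOpen
  have h1 := (hc.L_pos hz).ne'
  have he : c.es x ≠ 0 := (Real.exp_pos _).ne'
  have hR := hc.smP_q.pd1 hΩ
  have hR0 := hc.eulerP_q.pd1 hΩ hc.smP_q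
  have hP0 := hc.eulerP_q.pd2 hΩ hc.smP_q _ _ (hc.mem x y hz)
  rw [sub_self] at hR0 hP0
  refine (((hc.hasDy_comp_zero hR hR0 hz j).mul ((hc.hasDy_L hz j).inv h1)).congr hc.isOpen hz
    fun x y hz => hc.pm1_eq hz).congr_val ?_
  rw [hc.smP_q.pd1_pd2_comm hΩ (hc.mem x y hz)] at hP0
  have e1 : pd2 (pd2 fun s t => c.f s t * pd2 c.f s t) (c.Lt x y) (c.β x y) = c.p02 x y :=
    pd2_congr hΩ (hc.mem x y hz) fun s t hw => hc.pd2_q hw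
  rw [e1] at hP0
  rw [hc.pm1_eq hz]
  have e2 : c.Lt x y = c.es x * c.L x y := rfl
  generalize pd1 (fun s t => c.f s t * pd2 c.f s t) (c.Lt x y) (c.β x y) = R at *
  generalize pd2 (pd1 fun s t => c.f s t * pd2 c.f s t) (c.Lt x y) (c.β x y) = Z at *
  field_simp
  linear_combination c.L x y * c.m j x y * hP0 - c.L x y * c.m j x y * Z * e2

lemma hasDy_m (hz : (x, y) ∈ U) (i j : Fin n) :
    HasDir (c.m i) x y (vy j)
      (-(c.b j x / c.L x y ^ 2 - 2 * c.β x y * c.yl j x y / c.L x y ^ 4) * c.yl i x y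
        - c.β x y / c.L x y ^ 2 * c.g x y i j) := by
  have h1 := (hc.L_pos hz).ne'
  have hL2 := ((hc.hasDy_L hz j).mul (hc.hasDy_L hz j)).inv (mul_ne_zero h1 h1)
  refine (((hc.hasDy_b hz i j).sub (((hc.hasDy_β hz j).mul hL2).mul
    (hc.hasDy_yl hz i j))).congr hc.isOpen hz fun x y _ => ?_).congr_val ?_
  · rw [ChangeData.m]
    ring
  · field_simp
    ring

/-! The metric and the Cartan tensor of the changed structure. -/

lemma hasDy_fv_sq (hz : (x, y) ∈ U) (j : Fin n) :
    HasDir (fun x y => c.fv x y ^ 2) x y (vy j)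
      (2 * (c.es x * c.p x y * c.yl j x y + c.q x y * c.b j x)) := by
  have h1 := (hc.L_pos hz).ne'
  have h := hc.hasDy_comp_one hc.smP hz j
  refine ((h.mul h).congr hc.isOpen hz fun x y _ => sq _).congr_val ?_
  rw [ChangeData.p, ChangeData.q]
  field_simp
  rw [ChangeData.fv, ChangeData.f1, ChangeData.f2]
  ring

lemma dy_fv_sq (hz : (x, y) ∈ U) (j : Fin n) : dy j (fun x y => c.fv x y ^ 2) x y
    = 2 * (c.es x * c.p x y * c.yl j x y + c.q x y * c.b j x) := (hc.hasDy_fv_sq hz j).dy_eq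

/-- The vertical derivative of ½ ∂̇_i L̄² = e^σ p y_i + q b_i. -/
lemma metric_fv (hz : (x, y) ∈ U) (i j : Fin n) : metric c.fv x y i j
    = c.es x * c.p x y * c.g x y i j + c.es x * c.pm1 x y * c.m j x y * c.yl i x y
      + c.Q j x y * c.b i x := by
  rw [hc.changed.metric_symm hz]
  have h := ((((hc.hasDy_es hz j).mul (hc.hasDy_p hz j)).mul (hc.hasDy_yl hz i j)).add
    ((hc.hasDy_q hz j).mul (hc.hasDy_b hz i j))).const_mul 2
  have e := (h.congr hc.isOpen hz fun x y hz => hc.dy_fv_sq hz i).dy_eq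
  rw [dy_dy_sq] at e
  linear_combination 1 / 2 * e

/-- Since Q_i = ∂̇_i q by `hasDy_q`, the tensor B_ij is half the vertical Hessian of q. -/
lemma hasDy_Q (hz : (x, y) ∈ U) (i j : Fin n) :
    HasDir (c.Q i) x y (vy j) (2 * c.B i j x y) := by
  have h1 := (hc.L_pos hz).ne'
  have he : c.es x ≠ 0 := (Real.exp_pos _).ne'
  refine ((((hc.hasDy_es hz j).mul (hc.hasDy_pm1 hz j)).mul (hc.hasDy_yl hz i j)).add
    ((hc.hasDy_p0 hz j).mul (hc.hasDy_b hz i j))).congr_val ?_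
  -- Eliminating b_i in favour of m_i and y_i makes both sides polynomials in the same quantities.
  rw [ChangeData.B, hc.h_eq hz, show c.b i x = c.m i x y + c.β x y / c.L x y ^ 2 * c.yl i x y by
    rw [ChangeData.m]; ring]
  field_simp
  ring

lemma hasDy_g (hz : (x, y) ∈ U) (i j k : Fin n) :
    HasDir (fun x y => c.g x y i j) x y (vy k) (2 * cartan c.L i j k x y) :=
  ((hc.base.sm_metric i j).hasDy hc.isOpen hz k).congr_val (dy_metric _ _ _ _)

/-- Half the vertical derivative of `metric_fv`; everything besides the Cartan tensor of L collects
into V_ijk. -/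
lemma cartan_fv (hz : (x, y) ∈ U) (i j k : Fin n) : cartan c.fv i j k x y
    = c.es x * c.p x y * cartan c.L i j k x y + c.V i j k x y := by
  have h1 := (hc.L_pos hz).ne'
  have he : c.es x ≠ 0 := (Real.exp_pos _).ne'
  have h := (((((hc.hasDy_es hz k).mul (hc.hasDy_p hz k)).mul (hc.hasDy_g hz i j k)).add
    ((((hc.hasDy_es hz k).mul (hc.hasDy_pm1 hz k)).mul (hc.hasDy_m hz j k)).mul
      (hc.hasDy_yl hz i k))).add ((hc.hasDy_Q hz j k).mul (hc.hasDy_b hz i k)))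
  have e := (h.congr hc.isOpen hz fun x y hz => hc.metric_fv hz i j).dy_eq
  rw [dy_metric] at e
  rw [ChangeData.V, show cartan c.fv i j k x y = 1 / 2 * (2 * cartan c.fv i j k x y) by ring, e]
  simp only [hc.h_eq hz, ChangeData.B]
  rw [show c.g x y k i = c.g x y i k from hc.base.metric_symm hz k i]
  rw [show c.b i x = c.m i x y + c.β x y / c.L x y ^ 2 * c.yl i x y by
      rw [ChangeData.m]; ring,
    show c.b k x = c.m k x y + c.β x y / c.L x y ^ 2 * c.yl k x y by
      rw [ChangeData.m]; ring]
  field_simp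
  ring

end IsLocalChange

end Change

/-! ### Difference of the sprays and Barthel connections, lowered with the changed metric -/

section Difference

variable {c : ChangeData n} {U : Set (Coord n × Coord n)} {Ω : Set (ℝ × ℝ)} {x y : Coord n}

namespace ChangeData

variable (c)

/-- `∂̇_i (e^σ p L²)`. -/
def R (i : Fin n) (x y : Coord n) : ℝ :=
  2 * c.es x * c.p x y * c.yl i x y + c.es x * c.L x y ^ 2 * c.pm1 x y * c.m i x y

/-- Twice the difference of the canonical sprays, lowered with the changed metric. -/
def X (i : Fin n) (x y : Coord n) : ℝ :=
  c.E00 x y * c.Q i x y + 2 * c.q x y * c.F0 i x y + c.σ0 x y * c.R i x y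
    - c.es x * c.p x y * c.L x y ^ 2 * c.σd i x y

lemma dy_b (i j : Fin n) (x y : Coord n) : dy j (fun x _ => c.b i x) x y = 0 := by simp [dy]

lemma bcov_eq (i j : Fin n) (x y : Coord n) :
    c.bcov i j x y = dx j (fun x _ => c.b i x) x y
      - ∑ r, c.b r x * cartanGamma c.L r i j x y := by
  simp [bcov, hder, dy_b]

lemma sum_F0_mul_coord (x y : Coord n) : ∑ i, c.F0 i x y * y i = 0 := by
  have h : ∑ i, c.F0 i x y * y i = ∑ i, ∑ k, c.F i k x y * y k * y i := by
    simp only [ChangeData.F0, Finset.sum_mul]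
  have h2 : ∑ i, ∑ k, c.F i k x y * y k * y i = -∑ i, ∑ k, c.F i k x y * y k * y i := by
    conv_lhs => rw [Finset.sum_comm]
    simp only [← Finset.sum_neg_distrib]
    exact Finset.sum_congr rfl fun i _ => Finset.sum_congr rfl fun k _ => by
      rw [ChangeData.F, ChangeData.F]; ring
  linarith

lemma E00_eq (x y : Coord n) : c.E00 x y = ∑ i, c.E0 i x y * y i := by
  simp only [ChangeData.E00, ChangeData.E0, Finset.sum_mul]
  exact Finset.sum_congr rfl fun i _ => Finset.sum_congr rfl fun k _ => by ring

lemma sum_F_mul_coord (j : Fin n) (x y : Coord n) :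
    ∑ i, c.F i j x y * y i = -c.F0 j x y := by
  rw [ChangeData.F0, ← Finset.sum_neg_distrib]
  exact Finset.sum_congr rfl fun i _ => by rw [ChangeData.F, ChangeData.F]; ring

end ChangeData

namespace IsLocalChange

variable (hc : IsLocalChange c U Ω)
include hc

lemma hasDy_dx_b (hz : (x, y) ∈ U) (i j k : Fin n) :
    HasDir (dx i fun x _ => c.b j x) x y (vy k) 0 :=
  (((hc.smooth_b j).dx hc.isOpen i).hasDy hc.isOpen hz k).congr_val (by simp [dy, dx])

lemma hasDy_σd (hz : (x, y) ∈ U) (i k : Fin n) : HasDir (c.σd i) x y (vy k) 0 :=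
  ((hc.smooth_σ.dx hc.isOpen i).hasDy hc.isOpen hz k).congr_val (by simp [dy, dx])

lemma hasDy_σ0 (hz : (x, y) ∈ U) (k : Fin n) : HasDir c.σ0 x y (vy k) (c.σd k x y) := by
  refine (HasDir.sum fun i => (hc.hasDy_σd hz i k).mul (HasDir.coord i)).congr_val ?_
  simp only [zero_mul, zero_add]
  rw [← sum_vy_mul k fun i => c.σd i x y]
  exact Finset.sum_congr rfl fun i _ => mul_comm _ _

/-- The symmetry of Γ cancels the connection terms, so F_ij is half the curl of b and depends on x
alone. -/
lemma F_eq (hz : (x, y) ∈ U) (i j : Fin n) : c.F i j x y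
    = (dx j (fun x _ => c.b i x) x y - dx i (fun x _ => c.b j x) x y) / 2 := by
  rw [ChangeData.F, c.bcov_eq, c.bcov_eq,
    Finset.sum_congr rfl fun r _ => by rw [hc.base.cartanGamma_symm hz r i j]]
  ring

lemma sum_bcov_mul_coord (hz : (x, y) ∈ U) (i : Fin n) : ∑ k, c.bcov i k x y * y k
    = ∑ k, dx k (fun x _ => c.b i x) x y * y k - ∑ r, c.b r x * barthel c.L r i x y := by
  simp only [c.bcov_eq, sub_mul, Finset.sum_sub_distrib, Finset.sum_mul]
  congr 1
  rw [Finset.sum_comm]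
  refine Finset.sum_congr rfl fun r _ => ?_
  rw [← hc.base.sum_cartanGamma_mul_coord hz r i, Finset.mul_sum]
  exact Finset.sum_congr rfl fun k _ => by ring

lemma b0cov_eq (hz : (x, y) ∈ U) (j : Fin n) : c.b0cov j x y
    = ∑ k, dx j (fun x _ => c.b k x) x y * y k - ∑ r, c.b r x * barthel c.L r j x y := by
  simp only [ChangeData.b0cov, c.bcov_eq, sub_mul, Finset.sum_sub_distrib, Finset.sum_mul]
  congr 1
  rw [Finset.sum_comm]
  refine Finset.sum_congr rfl fun r _ => ?_
  rw [← hc.base.sum_cartanGamma_mul_coord hz r j, Finset.mul_sum]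
  exact Finset.sum_congr rfl fun k _ => by rw [hc.base.cartanGamma_symm hz]; ring

lemma F0_eq (hz : (x, y) ∈ U) (i : Fin n) : c.F0 i x y
    = (∑ k, dx k (fun x _ => c.b i x) x y * y k - ∑ k, dx i (fun x _ => c.b k x) x y * y k) / 2 := by
  rw [ChangeData.F0, ← Finset.sum_sub_distrib, Finset.sum_div]
  exact Finset.sum_congr rfl fun k _ => by rw [hc.F_eq hz]; ring

lemma E0_eq (hz : (x, y) ∈ U) (i : Fin n) : c.E0 i x y
    = (∑ k, dx k (fun x _ => c.b i x) x y * y k + ∑ k, dx i (fun x _ => c.b k x) x y * y k) / 2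
      - ∑ r, c.b r x * barthel c.L r i x y := by
  have h : c.E0 i x y = (∑ k, c.bcov i k x y * y k + c.b0cov i x y) / 2 := by
    rw [ChangeData.E0, ChangeData.b0cov, ← Finset.sum_add_distrib, Finset.sum_div]
    exact Finset.sum_congr rfl fun k _ => by rw [ChangeData.E]; ring
  rw [h, hc.sum_bcov_mul_coord hz, hc.b0cov_eq hz]
  ring

lemma b0cov_eq_sub (hz : (x, y) ∈ U) (i : Fin n) :
    c.b0cov i x y = c.E0 i x y - c.F0 i x y := by
  rw [hc.b0cov_eq hz, hc.E0_eq hz, hc.F0_eq hz]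
  ring

lemma sum_b0cov_mul_coord (hz : (x, y) ∈ U) : ∑ i, c.b0cov i x y * y i = c.E00 x y := by
  simp only [hc.b0cov_eq_sub hz, sub_mul, Finset.sum_sub_distrib, c.sum_F0_mul_coord,
    c.E00_eq, sub_zero]

/-- In this form the connection enters only through the spray, whose vertical derivative is the
Barthel connection; that makes `hasDy_E00` immediate. -/
lemma E00_eq_spray (hz : (x, y) ∈ U) : c.E00 x y
    = ∑ j, (∑ k, dx j (fun x _ => c.b k x) x y * y k) * y j
      - 2 * ∑ r, c.b r x * spray c.L r x y := by
  rw [← hc.sum_b0cov_mul_coord hz]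
  simp only [hc.b0cov_eq hz, sub_mul, Finset.sum_sub_distrib]
  congr 1
  simp only [Finset.sum_mul, Finset.mul_sum]
  rw [Finset.sum_comm]
  refine Finset.sum_congr rfl fun r _ => ?_
  calc _ = c.b r x * ∑ j, barthel c.L r j x y * y j := by
        rw [Finset.mul_sum]
        exact Finset.sum_congr rfl fun k _ => by ring
    _ = _ := by rw [hc.base.sum_barthel_mul_coord hz]; ring

lemma hasDy_E00 (hz : (x, y) ∈ U) (i : Fin n) : HasDir c.E00 x y (vy i) (2 * c.E0 i x y) := by
  have h := (HasDir.sum (s := Finset.univ) fun j => (HasDir.sum (s := Finset.univ) fun k =>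
      (hc.hasDy_dx_b hz j k i).mul (HasDir.coord (x := x) (y := y) (v := vy i) k)).mul
        (HasDir.coord (x := x) (y := y) (v := vy i) j)).sub
    ((HasDir.sum (s := Finset.univ) fun r => (hc.hasDy_b hz r i).mul
      ((hc.base.sm_spray r).hasDy hc.isOpen hz i)).const_mul 2)
  refine (h.congr hc.isOpen hz fun x y hz => hc.E00_eq_spray hz).congr_val ?_
  rw [hc.E0_eq hz]
  simp only [zero_mul, zero_add, Finset.sum_add_distrib]
  have e1 : ∀ a : Fin n → ℝ, ∑ k, a k * (vy i).2 k = a i := fun a => by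
    rw [← sum_vy_mul i a]
    exact Finset.sum_congr rfl fun k _ => mul_comm _ _
  rw [e1 fun j => ∑ k, dx j (fun x _ => c.b k x) x y * y k]
  simp only [e1 fun k => dx _ (fun x _ => c.b k x) x y]
  simp only [barthel]
  ring

lemma hasDy_F0 (hz : (x, y) ∈ U) (i j : Fin n) : HasDir (c.F0 i) x y (vy j) (c.F i j x y) := by
  have h := (HasDir.sum (s := Finset.univ) fun k =>
    (((hc.hasDy_dx_b hz k i j).sub (hc.hasDy_dx_b hz i k j)).const_mul (1 / 2)).mul
      (HasDir.coord (x := x) (y := y) (v := vy j) k))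
  refine (h.congr hc.isOpen hz fun x y hz => ?_).congr_val ?_
  · exact Finset.sum_congr rfl fun k _ => by rw [hc.F_eq hz]; ring
  · rw [hc.F_eq hz]
    simp only [sub_zero, mul_zero, zero_mul, zero_add, mul_comm _ ((vy j).2 _)]
    rw [sum_vy_mul j fun k => 1 / 2 * (dx k (fun x _ => c.b i x) x y - dx i (fun x _ => c.b k x) x y)]
    ring

lemma hasDy_esp (hz : (x, y) ∈ U) (i : Fin n) :
    HasDir (fun x y => c.es x * c.p x y * c.L x y ^ 2) x y (vy i) (c.R i x y) := by
  have h1 := (hc.L_pos hz).ne'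
  refine ((((hc.hasDy_es hz i).mul (hc.hasDy_p hz i)).mul
    ((hc.hasDy_L hz i).mul (hc.hasDy_L hz i))).congr hc.isOpen hz
      fun x y _ => by rw [sq]).congr_val ?_
  rw [ChangeData.R]
  field_simp
  ring

lemma hasDy_R (hz : (x, y) ∈ U) (i j : Fin n) : HasDir (c.R i) x y (vy j)
    (2 * c.es x * c.p x y * c.g x y i j + 2 * c.es x * c.pm1 x y * c.m j x y * c.yl i x y
        - 2 * c.β x y * c.B i j x y
        + c.es x * c.pm1 x y * (c.b i x * c.yl j x y - c.b j x * c.yl i x y)) := by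
  have h1 := (hc.L_pos hz).ne'
  have he : c.es x ≠ 0 := (Real.exp_pos _).ne'
  have h := ((((hc.hasDy_es hz j).mul (hc.hasDy_p hz j)).mul (hc.hasDy_yl hz i j)).const_mul 2).add
    ((((hc.hasDy_es hz j).mul ((hc.hasDy_L hz j).mul (hc.hasDy_L hz j))).mul
      (hc.hasDy_pm1 hz j)).mul (hc.hasDy_m hz i j))
  refine (h.congr hc.isOpen hz fun x y _ => by rw [ChangeData.R]; ring).congr_val ?_
  rw [ChangeData.B, hc.h_eq hz, show c.b i x = c.m i x y + c.β x y / c.L x y ^ 2 * c.yl i x y by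
      rw [ChangeData.m]; ring,
    show c.b j x = c.m j x y + c.β x y / c.L x y ^ 2 * c.yl j x y by
      rw [ChangeData.m]; ring]
  field_simp
  ring

lemma hasDy_X (hz : (x, y) ∈ U) (i j : Fin n) : HasDir (c.X i) x y (vy j)
    (2 * (c.E00 x y * c.B i j x y + c.F0 i x y * c.Q j x y + c.q x y * c.F i j x y
      + c.E0 j x y * c.Q i x y)
      + c.σ0 x y * (2 * c.es x * c.p x y * c.g x y i j
        + 2 * c.es x * c.pm1 x y * c.m j x y * c.yl i x y - 2 * c.β x y * c.B i j x y
        + c.es x * c.pm1 x y * (c.b i x * c.yl j x y - c.b j x * c.yl i x y))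
      - c.σd i x y * c.R j x y + c.σd j x y * c.R i x y) := by
  have h := ((((hc.hasDy_E00 hz j).mul (hc.hasDy_Q hz i j)).add
    (((hc.hasDy_q hz j).mul (hc.hasDy_F0 hz i j)).const_mul 2)).add
    ((hc.hasDy_σ0 hz j).mul (hc.hasDy_R hz i j))).sub
    ((hc.hasDy_esp hz j).mul (hc.hasDy_σd hz i j))
  refine (h.congr hc.isOpen hz fun x y _ => by rw [ChangeData.X]; ring).congr_val ?_
  ring

/-- The horizontal derivative of the square of the changed fundamental function. -/
lemma dx_fv_sq (hz : (x, y) ∈ U) (k : Fin n) : dx k (fun x y => c.fv x y ^ 2) x y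
    = 2 * (c.es x * c.p x y * c.L x y ^ 2 * c.σd k x y + c.q x y * c.b0cov k x y)
      + ∑ r, barthel c.L r k x y * dy r (fun x y => c.fv x y ^ 2) x y := by
  have h1 := (hc.L_pos hz).ne'
  have hLt : HasDir c.Lt x y (vx k)
      (c.es x * (c.σd k x y * c.L x y + dx k c.L x y)) :=
    (((hc.smooth_σ.hasDx hc.isOpen hz k).exp).mul
      (hc.base.smooth.hasDx hc.isOpen hz k)).congr_val (by
        rw [ChangeData.σd, ChangeData.es]; ring)
  have hβ : HasDir c.β x y (vx k) (∑ i, dx k (fun x _ => c.b i x) x y * y i) :=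
    (HasDir.sum fun i => ((hc.smooth_b i).hasDx hc.isOpen hz k).mul
      (HasDir.coord i)).congr_val (Finset.sum_congr rfl fun i _ => by simp [vx])
  have h : HasDir c.fv x y (vx k) _ :=
    HasDir.comp₂ (hc.smP.differentiableAt hc.hom_f.isOpen (hc.mem x y hz)) hLt hβ
  rw [((h.mul h).congr hc.isOpen hz fun x y _ => sq _).dx_eq]
  -- Horizontal constancy of L puts the Barthel term in a shape that cancels ∂_k L and completes ∂_k
  -- b_i y^i to b_{0|k}.
  have e : ∑ r, barthel c.L r k x y * dy r (fun x y => c.fv x y ^ 2) x y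
      = 2 * (c.es x * c.p x y * c.L x y * dx k c.L x y
        + c.q x y * ∑ r, c.b r x * barthel c.L r k x y) := by
    rw [hc.base.dx_eq hz, Finset.mul_sum, Finset.mul_sum, ← Finset.sum_add_distrib, Finset.mul_sum]
    exact Finset.sum_congr rfl fun r _ => by rw [hc.dy_fv_sq hz, hc.yl_eq hz]; ring
  rw [e, hc.b0cov_eq hz, ChangeData.q, ChangeData.p]
  field_simp
  rw [ChangeData.fv, ChangeData.f1, ChangeData.f2]
  ring

lemma sum_coord_mul_dx_fv_sq (hz : (x, y) ∈ U) :
    ∑ k, y k * dx k (fun x y => c.fv x y ^ 2) x y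
      = 2 * (c.es x * c.p x y * c.L x y ^ 2 * c.σ0 x y + c.q x y * c.E00 x y)
        + 2 * ∑ r, spray c.L r x y * dy r (fun x y => c.fv x y ^ 2) x y := by
  simp only [hc.dx_fv_sq hz, mul_add, Finset.sum_add_distrib]
  rw [← hc.sum_b0cov_mul_coord hz, ChangeData.σ0]
  simp only [Finset.mul_sum]
  congr 1
  · congr 1 <;> exact Finset.sum_congr rfl fun r _ => by ring
  · rw [Finset.sum_comm]
    refine Finset.sum_congr rfl fun r _ => ?_
    calc _ = (∑ j, barthel c.L r j x y * y j) * dy r (fun x y => c.fv x y ^ 2) x y := by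
          rw [Finset.sum_mul]
          exact Finset.sum_congr rfl fun k _ => by ring
      _ = _ := by rw [hc.base.sum_barthel_mul_coord hz]; ring

/-- The Euler–Lagrange form of Ḡ needs y^k ∂_k ∂̇_i L̄² − ∂_i L̄². The vertical derivative of
`sum_coord_mul_dx_fv_sq` gives the same expression with a plus sign, and `dx_fv_sq` gives ∂_i L̄².
-/
lemma sum_metric_fv_mul_spray_sub (hz : (x, y) ∈ U) (i : Fin n) :
    ∑ r, metric c.fv x y i r * (spray c.fv r x y - spray c.L r x y) = 1 / 2 * c.X i x y := by
  have hl := HasDir.sum (s := Finset.univ) fun k =>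
    (HasDir.coord (x := x) (y := y) (v := vy i) k).mul
      ((hc.changed.sm_sq.dx hc.isOpen k).hasDy hc.isOpen hz i)
  have hr := ((((hc.hasDy_esp hz i).mul (hc.hasDy_σ0 hz i)).add
    ((hc.hasDy_q hz i).mul (hc.hasDy_E00 hz i))).const_mul 2).add
    ((HasDir.sum (s := Finset.univ) fun r => ((hc.base.sm_spray r).hasDy hc.isOpen hz i).mul
      ((hc.changed.sm_dy_sq r).hasDy hc.isOpen hz i)).const_mul 2)
  have h := hl.unique (hr.congr hc.isOpen hz fun x y hz => hc.sum_coord_mul_dx_fv_sq hz)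
  rw [Finset.sum_add_distrib, Finset.sum_add_distrib, sum_vy_mul i] at h
  have e1 : ∑ r, spray c.L r x y * dy i (dy r fun x y => c.fv x y ^ 2) x y
      = 2 * ∑ r, metric c.fv x y i r * spray c.L r x y := by
    rw [Finset.mul_sum]
    exact Finset.sum_congr rfl fun r _ => by rw [dy_dy_sq]; ring
  rw [e1, Finset.sum_congr rfl fun k _ => by rw [hc.changed.sm_sq.dy_dx_comm hc.isOpen hz]] at h
  have h2 := hc.changed.sum_metric_mul_spray hz i
  have h3 := hc.dx_fv_sq hz i
  rw [hc.b0cov_eq_sub hz] at h3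
  simp only [mul_sub, Finset.sum_sub_distrib]
  simp only [barthel] at h3
  rw [ChangeData.X]
  -- The Barthel terms cancel, and so does E_i0, because b_{0|i} = E_i0 − F_i0; what survives of
  -- them is 2 q F_i0.
  linear_combination 1 / 4 * h2 + 1 / 4 * h - 1 / 2 * h3

/-- The vertical derivative of the difference of the sprays, lowered with the changed metric. -/
lemma sum_metric_fv_mul_barthel_sub (hz : (x, y) ∈ U)
    (hD : ∀ r, spray c.fv r x y - spray c.L r x y = c.D r x y) (i j : Fin n) :
    ∑ r, metric c.fv x y i r * (barthel c.fv r j x y - barthel c.L r j x y) = c.A i j x y := by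
  have hl := HasDir.sum (s := Finset.univ) fun r =>
    ((hc.changed.sm_metric i r).hasDy hc.isOpen hz j).mul
      (((hc.changed.sm_spray r).hasDy hc.isOpen hz j).sub
        ((hc.base.sm_spray r).hasDy hc.isOpen hz j))
  have h := hl.unique (((hc.hasDy_X hz i j).const_mul (1 / 2)).congr hc.isOpen hz
    fun x y hz => hc.sum_metric_fv_mul_spray_sub hz i)
  rw [Finset.sum_add_distrib] at h
  simp only [hD] at h
  -- The product rule also differentiates ḡ_ir, which yields the Cartan tensor of L̄ contracted with
  -- D.
  have e : ∑ r, dy j (fun x y => metric c.fv x y i r) x y * c.D r x y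
      = 2 * ∑ s, (c.es x * c.p x y * cartan c.L s i j x y + c.V s i j x y) * c.D s x y := by
    rw [Finset.mul_sum]
    exact Finset.sum_congr rfl fun r _ => by
      rw [dy_metric, hc.changed.cartan_swap_left hz, hc.cartan_fv hz]; ring
  rw [e] at h
  simp only [barthel]
  rw [ChangeData.A]
  simp only [ChangeData.R] at h
  linear_combination h

/-! Contractions with `y` and `b`. -/

lemma sum_yl_mul_coord (hz : (x, y) ∈ U) : ∑ i, c.yl i x y * y i = c.L x y ^ 2 := by
  have := hc.base.sum_coord_mul_dy hz
  simp only [hc.yl_eq hz]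
  calc _ = c.L x y * ∑ j, y j * dy j c.L x y := by
        rw [Finset.mul_sum]
        exact Finset.sum_congr rfl fun k _ => by ring
    _ = _ := by rw [this]; ring

lemma sum_m_mul_coord (hz : (x, y) ∈ U) : ∑ i, c.m i x y * y i = 0 := by
  have h1 := (hc.L_pos hz).ne'
  simp only [ChangeData.m, sub_mul, Finset.sum_sub_distrib, mul_assoc, ← Finset.mul_sum,
    hc.sum_yl_mul_coord hz]
  rw [ChangeData.β]
  field_simp
  ring

lemma sum_g_mul_coord (hz : (x, y) ∈ U) (j : Fin n) : ∑ i, c.g x y i j * y i = c.yl j x y := by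
  simp only [ChangeData.yl]
  exact Finset.sum_congr rfl fun i _ => by rw [ChangeData.g, hc.base.metric_symm hz]; rfl

lemma sum_B_mul_coord (hz : (x, y) ∈ U) (j : Fin n) : ∑ i, c.B i j x y * y i = 0 := by
  have h1 := (hc.L_pos hz).ne'
  have e : ∀ i, c.B i j x y * y i = c.es x * c.pm1 x y / 2 * (c.g x y i j * y i)
      - c.es x * c.pm1 x y / 2 * c.yl j x y / c.L x y ^ 2 * (c.yl i x y * y i)
      + c.p02 x y * c.m j x y / 2 * (c.m i x y * y i) := fun i => by
    rw [ChangeData.B, hc.h_eq hz]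
    ring
  simp only [e, Finset.sum_add_distrib, Finset.sum_sub_distrib, ← Finset.mul_sum,
    hc.sum_g_mul_coord hz, hc.sum_yl_mul_coord hz, hc.sum_m_mul_coord hz]
  field_simp
  ring

lemma sum_Q_mul_coord (hz : (x, y) ∈ U) : ∑ i, c.Q i x y * y i = c.q x y := by
  simp only [ChangeData.Q, add_mul, Finset.sum_add_distrib, mul_assoc, ← Finset.mul_sum,
    hc.sum_yl_mul_coord hz]
  rw [hc.q_eq hz, ChangeData.β]
  ring

lemma sum_R_mul_coord (hz : (x, y) ∈ U) :
    ∑ i, c.R i x y * y i = 2 * c.es x * c.p x y * c.L x y ^ 2 := by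
  simp only [ChangeData.R, add_mul, Finset.sum_add_distrib, mul_assoc, ← Finset.mul_sum,
    hc.sum_yl_mul_coord hz, hc.sum_m_mul_coord hz]
  ring

/-- The inverse of ḡ applied to A_ij involves this contraction, and its value is the scalar in the
last term of D^i_j. The tensors B_ij and C̄_sij drop out because they annihilate y. -/
lemma sum_A_mul_coord (hz : (x, y) ∈ U) (j : Fin n) : ∑ i, c.A i j x y * y i
    = c.q x y * c.b0cov j x y + c.es x * c.p x y * c.L x y ^ 2 * c.σd j x y := by
  have h1 := (hc.L_pos hz).ne'
  have e : ∀ i, c.A i j x y * y i = (c.E00 x y - c.σ0 x y * c.β x y) * (c.B i j x y * y i)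
      + c.Q j x y * (c.F0 i x y * y i) + c.q x y * (c.F i j x y * y i)
      + c.E0 j x y * (c.Q i x y * y i)
      - 2 * ((∑ s, cartan c.fv s i j x y * c.D s x y) * y i)
      + c.σ0 x y * c.es x * c.p x y * (c.g x y i j * y i)
      + c.σ0 x y * c.es x * c.pm1 x y * (c.m j x y - 1 / 2 * c.b j x) * (c.yl i x y * y i)
      + 1 / 2 * c.σ0 x y * c.es x * c.pm1 x y * c.yl j x y * (c.b i x * y i)
      - 1 / 2 * c.R j x y * (c.σd i x y * y i) + 1 / 2 * c.σd j x y * (c.R i x y * y i) := by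
    intro i
    simp only [hc.cartan_fv hz, ChangeData.A, ChangeData.R]
    ring
  have eC : ∑ i, (∑ s, cartan c.fv s i j x y * c.D s x y) * y i = 0 := by
    simp only [Finset.sum_mul]
    rw [Finset.sum_comm]
    refine Finset.sum_eq_zero fun s _ => ?_
    calc _ = c.D s x y * ∑ i, cartan c.fv s j i x y * y i := by
          rw [Finset.mul_sum]
          exact Finset.sum_congr rfl fun i _ => by rw [hc.changed.cartan_swap_right hz]; ring
      _ = _ := by rw [hc.changed.sum_cartan_mul_coord hz]; ring
  have eb : ∑ i, c.b i x * y i = c.β x y := rfl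
  have eσ : ∑ i, c.σd i x y * y i = c.σ0 x y := rfl
  simp only [e, Finset.sum_add_distrib, Finset.sum_sub_distrib, ← Finset.mul_sum, eC, eb, eσ,
    hc.sum_B_mul_coord hz, c.sum_F0_mul_coord, c.sum_F_mul_coord, hc.sum_Q_mul_coord hz,
    hc.sum_g_mul_coord hz, hc.sum_yl_mul_coord hz, hc.sum_R_mul_coord hz]
  rw [hc.b0cov_eq_sub hz, ChangeData.R, ChangeData.m]
  field_simp
  ring

end IsLocalChange

end Difference

/-! ### Inversion of the changed metric -/

section Inverse

variable {c : ChangeData n} {U : Set (Coord n × Coord n)} {Ω : Set (ℝ × ℝ)} {x y : Coord n}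

namespace ChangeData

/-- The covector `w` with its index raised by the metric of `L`. -/
def up (c : ChangeData n) (x y : Coord n) (w : Fin n → ℝ) (i : Fin n) : ℝ :=
  ∑ j, c.gi x y i j * w j

/-- `e^σ p + m² q_0`, so that `ε = f² (e^σ p + m² q_0) / L²`. -/
def Δ (c : ChangeData n) (x y : Coord n) : ℝ := c.es x * c.p x y + c.msq x y * c.q0 x y

lemma es_pos (c : ChangeData n) (x : Coord n) : 0 < c.es x := Real.exp_pos _

lemma exp_neg_σ (c : ChangeData n) (x : Coord n) : Real.exp (-c.σ x) = (c.es x)⁻¹ :=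
  Real.exp_neg _

end ChangeData

namespace IsLocalChange

variable (hc : IsLocalChange c U Ω)
include hc

lemma sum_g_mul_up (hz : (x, y) ∈ U) (w : Fin n → ℝ) (i : Fin n) :
    ∑ r, c.g x y i r * c.up x y w r = w i :=
  hc.base.sum_metric_mul_metricInv hz w i

lemma up_yl (hz : (x, y) ∈ U) : c.up x y (fun i => c.yl i x y) = fun i => y i :=
  hc.base.metric_cancel hz fun i => hc.sum_g_mul_up hz _ i

lemma sum_yl_mul_up (hz : (x, y) ∈ U) (w : Fin n → ℝ) :
    ∑ r, c.yl r x y * c.up x y w r = ∑ r, w r * y r := by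
  simp only [ChangeData.yl, Finset.sum_mul]
  rw [Finset.sum_comm]
  refine Finset.sum_congr rfl fun s _ => ?_
  rw [← hc.sum_g_mul_up hz w s, Finset.sum_mul]
  exact Finset.sum_congr rfl fun r _ => by
    rw [show c.g x y s r = c.g x y r s from hc.base.metric_symm hz s r]; ring

lemma sum_mul_up_comm (hz : (x, y) ∈ U) (v w : Fin n → ℝ) :
    ∑ r, v r * c.up x y w r = ∑ r, w r * c.up x y v r := by
  simp only [ChangeData.up, Finset.mul_sum]
  rw [Finset.sum_comm]
  exact Finset.sum_congr rfl fun s _ => Finset.sum_congr rfl fun r _ => by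
    rw [show c.gi x y r s = c.gi x y s r from hc.base.metricInv_symm hz r s]; ring

lemma sum_b_mul_up (hz : (x, y) ∈ U) (w : Fin n → ℝ) :
    ∑ r, c.b r x * c.up x y w r = ∑ r, w r * c.bu r x y :=
  hc.sum_mul_up_comm hz (fun r => c.b r x) w

lemma sum_yl_mul_bu (hz : (x, y) ∈ U) : ∑ r, c.yl r x y * c.bu r x y = c.β x y :=
  hc.sum_yl_mul_up hz fun r => c.b r x

lemma up_m (hz : (x, y) ∈ U) (i : Fin n) :
    c.up x y (fun i => c.m i x y) i = c.bu i x y - c.β x y / c.L x y ^ 2 * y i := by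
  rw [← congrFun (hc.up_yl hz) i]
  simp only [ChangeData.up, ChangeData.m, ChangeData.bu, Finset.mul_sum, ← Finset.sum_sub_distrib]
  exact Finset.sum_congr rfl fun r _ => by ring

lemma sum_m_mul_bu (hz : (x, y) ∈ U) : ∑ r, c.m r x y * c.bu r x y
    = c.bsq x y - c.β x y ^ 2 / c.L x y ^ 2 := by
  simp only [ChangeData.m, sub_mul, Finset.sum_sub_distrib, mul_assoc, ← Finset.mul_sum,
    hc.sum_yl_mul_bu hz, ChangeData.bsq]
  congr 1
  · exact Finset.sum_congr rfl fun r _ => mul_comm _ _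
  · ring

lemma msq_eq (hz : (x, y) ∈ U) : c.msq x y = c.bsq x y - c.β x y ^ 2 / c.L x y ^ 2 := by
  have h : c.msq x y = ∑ r, c.m r x y * c.up x y (fun i => c.m i x y) r := by
    simp only [ChangeData.msq, ChangeData.up, Finset.mul_sum]
    exact Finset.sum_congr rfl fun s _ => Finset.sum_congr rfl fun r _ => by ring
  rw [h, ← hc.sum_m_mul_bu hz]
  simp only [hc.up_m hz, mul_sub, Finset.sum_sub_distrib]
  have := hc.sum_m_mul_coord hz
  have e : ∑ r, c.m r x y * (c.β x y / c.L x y ^ 2 * y r)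
      = c.β x y / c.L x y ^ 2 * ∑ r, c.m r x y * y r := by
    rw [Finset.mul_sum]
    exact Finset.sum_congr rfl fun r _ => by ring
  rw [e, this]
  ring

/-- Apart from e^σ p g, the changed metric has image in the span of b_i and y_i and depends on v
only through b_r v^r and y_r v^r. -/
lemma sum_metric_fv_mul (hz : (x, y) ∈ U) (v : Fin n → ℝ) (i : Fin n) :
    ∑ r, metric c.fv x y i r * v r
      = c.es x * c.p x y * ∑ r, c.g x y i r * v r
        + c.es x * c.pm1 x y * (∑ r, c.b r x * v r
            - c.β x y / c.L x y ^ 2 * ∑ r, c.yl r x y * v r) * c.yl i x y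
        + (c.es x * c.pm1 x y * ∑ r, c.yl r x y * v r + c.p0 x y * ∑ r, c.b r x * v r)
            * c.b i x := by
  simp only [hc.metric_fv hz, ChangeData.m, ChangeData.Q, mul_sub, add_mul, sub_mul, Finset.mul_sum,
    Finset.sum_mul, ← Finset.sum_add_distrib, ← Finset.sum_sub_distrib]
  exact Finset.sum_congr rfl fun r _ => by ring

/-- The changed metric applied to a combination of a raised covector, `b^i` and `y^i`. -/
lemma sum_metric_fv_mul_comb (hz : (x, y) ∈ U) (w : Fin n → ℝ) (α κ μ : ℝ) (i : Fin n) :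
    ∑ r, metric c.fv x y i r * (α * c.up x y w r + κ * c.bu r x y + μ * y r)
      = c.es x * c.p x y * α * w i
        + (c.es x * c.p x y * κ + c.es x * c.pm1 x y * (α * ∑ r, w r * y r)
            + c.p0 x y * (α * ∑ r, w r * c.bu r x y)
            + κ * (c.es x * c.pm1 x y * c.β x y + c.p0 x y * c.bsq x y)
            + μ * c.q x y) * c.b i x
        + (c.es x * c.p x y * μ + c.es x * c.pm1 x y * (α * ∑ r, w r * c.bu r x y
              - c.β x y / c.L x y ^ 2 * (α * ∑ r, w r * y r) + κ * c.msq x y)) * c.yl i x y := by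
  have hL := (hc.L_pos hz).ne'
  have split : ∀ a : Fin n → ℝ,
      ∑ r, a r * (α * c.up x y w r + κ * c.bu r x y + μ * y r)
        = α * ∑ r, a r * c.up x y w r + κ * ∑ r, a r * c.bu r x y + μ * ∑ r, a r * y r := by
    intro a
    simp only [Finset.mul_sum, ← Finset.sum_add_distrib]
    exact Finset.sum_congr rfl fun r _ => by ring
  have e1 : ∑ r, c.b r x * c.bu r x y = c.bsq x y :=
    Finset.sum_congr rfl fun r _ => mul_comm _ _
  have e2 : ∑ r, c.b r x * y r = c.β x y := rfl
  have e3 : ∑ r, c.g x y i r * y r = c.yl i x y := rfl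
  have e4 : ∑ r, c.g x y i r * c.bu r x y = c.b i x := hc.sum_g_mul_up hz (fun r => c.b r x) i
  rw [hc.sum_metric_fv_mul hz, split, split, split, hc.sum_g_mul_up hz, hc.sum_b_mul_up hz,
    hc.sum_yl_mul_up hz, hc.sum_yl_mul_coord hz, hc.sum_yl_mul_bu hz, e1, e2, e3, e4,
    hc.msq_eq hz, hc.q_eq hz]
  field_simp
  ring

lemma sum_X_mul_bu (hz : (x, y) ∈ U) : ∑ r, c.X r x y * c.bu r x y
    = c.E00 x y * (c.es x * c.pm1 x y * c.β x y + c.p0 x y * c.bsq x y)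
      + 2 * c.q x y * c.Fβ0 x y
      + c.σ0 x y * (2 * c.es x * c.p x y * c.β x y + c.es x * c.L x y ^ 2 * c.pm1 x y * c.msq x y)
      - c.es x * c.p x y * c.L x y ^ 2 * c.σβ x y := by
  have e1 : ∑ r, c.b r x * c.bu r x y = c.bsq x y :=
    Finset.sum_congr rfl fun r _ => mul_comm _ _
  have e2 : ∑ r, c.m r x y * c.bu r x y = c.msq x y := by
    rw [hc.sum_m_mul_bu hz, hc.msq_eq hz]
  rw [← e1, ← e2, ← hc.sum_yl_mul_bu hz, ChangeData.Fβ0, ChangeData.σβ]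
  simp only [Finset.mul_sum, ← Finset.sum_add_distrib, ← Finset.sum_sub_distrib, ChangeData.X,
    ChangeData.Q, ChangeData.R]
  exact Finset.sum_congr rfl fun r _ => by ring

lemma sum_X_mul_coord (hz : (x, y) ∈ U) : ∑ r, c.X r x y * y r
    = c.q x y * c.E00 x y + c.es x * c.p x y * c.L x y ^ 2 * c.σ0 x y := by
  have eσ : ∑ r, c.σd r x y * y r = c.σ0 x y := rfl
  have e : ∀ r, c.X r x y * y r = c.E00 x y * (c.Q r x y * y r)
      + 2 * c.q x y * (c.F0 r x y * y r) + c.σ0 x y * (c.R r x y * y r)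
      - c.es x * c.p x y * c.L x y ^ 2 * (c.σd r x y * y r) := fun r => by
    rw [ChangeData.X]; ring
  simp only [e, Finset.sum_add_distrib, Finset.sum_sub_distrib, ← Finset.mul_sum, eσ,
    c.sum_F0_mul_coord, hc.sum_Q_mul_coord hz, hc.sum_R_mul_coord hz]
  ring

lemma up_X (hz : (x, y) ∈ U) (i : Fin n) : c.up x y (fun i => c.X i x y) i
    = c.E00 x y * (c.es x * c.pm1 x y * y i + c.p0 x y * c.bu i x y)
      + 2 * c.q x y * c.Fu0 i x y
      + c.σ0 x y * (2 * c.es x * c.p x y * y i + c.es x * c.L x y ^ 2 * c.pm1 x y *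
          (c.bu i x y - c.β x y / c.L x y ^ 2 * y i))
      - c.es x * c.p x y * c.L x y ^ 2 * c.σu i x y := by
  have hF : c.Fu0 i x y = ∑ j, c.gi x y i j * c.F0 j x y := by
    simp only [ChangeData.Fu0, ChangeData.F0, Finset.mul_sum, mul_assoc]
  rw [hF, ← hc.up_m hz, ← congrFun (hc.up_yl hz) i, ChangeData.σu, ChangeData.bu]
  simp only [ChangeData.up, Finset.mul_sum, ← Finset.sum_add_distrib, ← Finset.sum_sub_distrib,
    ChangeData.X, ChangeData.Q, ChangeData.R]
  exact Finset.sum_congr rfl fun r _ => by ring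

/-- The relation behind the determinant of the changed metric on the span of `b^i` and `y^i`. -/
lemma det_eq (hz : (x, y) ∈ U) :
    c.es x * c.p x y * (c.es x * c.p x y + c.es x * c.pm1 x y * c.β x y + c.p0 x y * c.bsq x y)
      - c.es x * c.pm1 x y * c.msq x y * c.q x y = c.fv x y ^ 2 * c.Δ x y / c.L x y ^ 2 := by
  have hL := (hc.L_pos hz).ne'
  have hF := (hc.fv_pos hz).ne'
  -- The factor f² clears the denominator in q_0 = p_0 − q²/f².
  have e0 : c.fv x y ^ 2 * c.Δ x y = c.fv x y ^ 2 * (c.es x * c.p x y)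
      + c.msq x y * (c.p0 x y * c.fv x y ^ 2 - c.q x y ^ 2) := by
    rw [ChangeData.Δ, hc.q0_eq hz]
    field_simp
  rw [e0, hc.fv_sq_eq hz, hc.msq_eq hz, hc.q_eq hz]
  field_simp
  ring

variable (hp : c.p x y ≠ 0)
include hp

/-- If it vanished, a combination of b^i and y^i would lie in the kernel of ḡ and hence be zero.
Then b^i is a multiple of y^i, so m² = 0 and the expression reduces to e^σ p ≠ 0, a contradiction.
-/
lemma Δ_ne_zero (hz : (x, y) ∈ U) : c.Δ x y ≠ 0 := by
  intro h0
  have hL := (hc.L_pos hz).ne'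
  have he := (c.es_pos x).ne'
  have hd := hc.det_eq hz
  rw [h0, mul_zero, zero_div] at hd
  -- The coefficient of y^r makes the y_i-component of the image vanish; the b_i-component is then
  -- the left side of `det_eq` divided by e^σ p.
  have hv : (fun r => 0 * c.up x y 0 r + 1 * c.bu r x y
      + -(c.pm1 x y * c.msq x y / c.p x y) * y r) = 0 := by
    refine hc.changed.metric_cancel hz fun i => ?_
    rw [hc.sum_metric_fv_mul_comb hz]
    have h1 : c.es x * c.p x y + (c.es x * c.pm1 x y * c.β x y + c.p0 x y * c.bsq x y)
        + -(c.pm1 x y * c.msq x y / c.p x y) * c.q x y = 0 := by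
      field_simp
      refine mul_left_cancel₀ he ?_
      linear_combination hd
    simp only [Pi.zero_apply, zero_mul, mul_zero, Finset.sum_const_zero, one_mul, add_zero, zero_add,
      sub_zero, mul_one]
    rw [h1]
    field_simp
    ring
  set κ := c.pm1 x y * c.msq x y / c.p x y with hκ
  have hbu : ∀ r, c.bu r x y = κ * y r := fun r => by
    have := congrFun hv r
    simp only [Pi.zero_apply, zero_mul, zero_add, one_mul] at this
    linear_combination this
  have hβ : c.β x y = κ * c.L x y ^ 2 := by
    rw [← hc.sum_yl_mul_bu hz, ← hc.sum_yl_mul_coord hz, Finset.mul_sum]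
    exact Finset.sum_congr rfl fun r _ => by rw [hbu]; ring
  have hm : c.msq x y = 0 := by
    have : c.bsq x y = κ * c.β x y := by
      rw [ChangeData.bsq, ChangeData.β, Finset.mul_sum]
      exact Finset.sum_congr rfl fun r _ => by rw [hbu]; ring
    rw [hc.msq_eq hz, this, hβ]
    field_simp
    ring
  rw [ChangeData.Δ, hm, zero_mul, add_zero] at h0
  exact mul_ne_zero he hp h0

lemma s0_eq (hz : (x, y) ∈ U) : c.s0 x y = c.q0 x y / (c.es x * c.p x y * c.Δ x y) := by
  have hL := (hc.L_pos hz).ne'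
  have hF := (hc.fv_pos hz).ne'
  have he := (c.es_pos x).ne'
  have hΔ := hc.Δ_ne_zero hp hz
  have hε : c.ε x y = c.fv x y ^ 2 * c.Δ x y / c.L x y ^ 2 := rfl
  rw [ChangeData.s0, c.exp_neg_σ, hε]
  field_simp

lemma sm1_eq (hz : (x, y) ∈ U) : c.sm1 x y = c.pm1 x y / (c.p x y * c.Δ x y) := by
  have hL := (hc.L_pos hz).ne'
  have hF := (hc.fv_pos hz).ne'
  have hΔ := hc.Δ_ne_zero hp hz
  have hε : c.ε x y = c.fv x y ^ 2 * c.Δ x y / c.L x y ^ 2 := rfl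
  rw [ChangeData.sm1, hε]
  field_simp

/-- Euler's identity for f makes the numerator divisible by β, so one expression covers both
branches of the definition. -/
lemma sm2_eq (hz : (x, y) ∈ U) : c.sm2 x y
    = -(c.pm1 x y * (c.es x * c.p x y * c.β x y + c.bsq x y * c.q x y))
      / (c.p x y * c.Δ x y * c.fv x y ^ 2) := by
  have hL := (hc.L_pos hz).ne'
  have hF := (hc.fv_pos hz).ne'
  have hΔ := hc.Δ_ne_zero hp hz
  have hε : c.ε x y = c.fv x y ^ 2 * c.Δ x y / c.L x y ^ 2 := rfl
  rw [ChangeData.sm2, hε]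
  split_ifs with hβ
  · rw [hβ]
    field_simp
    ring
  · have e : c.es x * c.msq x y * c.p x y * c.L x y ^ 2 - c.bsq x y * c.fv x y ^ 2
        = -(c.β x y * (c.es x * c.p x y * c.β x y + c.bsq x y * c.q x y)) := by
      rw [hc.fv_sq_eq hz, hc.msq_eq hz]
      field_simp
      ring
    rw [e]
    field_simp

/-! The four scalar relations saying that the formula for the inverse metric is right. -/

lemma s0_relation (hz : (x, y) ∈ U) : c.p0 x y / (c.es x * c.p x y)
    = c.s0 x y * (c.es x * c.p x y + c.es x * c.pm1 x y * c.β x y + c.p0 x y * c.bsq x y)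
      + c.sm1 x y * c.q x y := by
  have hL := (hc.L_pos hz).ne'
  have he := (c.es_pos x).ne'
  have hΔ := hc.Δ_ne_zero hp hz
  have hF := (hc.fv_pos hz).ne'
  rw [hc.s0_eq hp hz, hc.sm1_eq hp hz]
  have hd := hc.det_eq hz
  have key : c.p0 x y * c.Δ x y = c.q0 x y * (c.es x * c.p x y + c.es x * c.pm1 x y * c.β x y
      + c.p0 x y * c.bsq x y) + c.es x * c.pm1 x y * c.q x y := by
    have h2 : c.q0 x y * c.fv x y ^ 2 = c.p0 x y * c.fv x y ^ 2 - c.q x y ^ 2 := by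
      rw [hc.q0_eq hz]
      field_simp
    have hF2 := pow_ne_zero 2 hF
    refine mul_left_cancel₀ hF2 (mul_left_cancel₀ (pow_ne_zero 2 hL) ?_)
    have e1 : c.fv x y ^ 2 * (c.q0 x y * (c.es x * c.p x y + c.es x * c.pm1 x y * c.β x y
        + c.p0 x y * c.bsq x y) + c.es x * c.pm1 x y * c.q x y)
        = (c.p0 x y * c.fv x y ^ 2 - c.q x y ^ 2) * (c.es x * c.p x y
          + c.es x * c.pm1 x y * c.β x y + c.p0 x y * c.bsq x y)
          + c.fv x y ^ 2 * (c.es x * c.pm1 x y * c.q x y) := by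
      linear_combination (c.es x * c.p x y + c.es x * c.pm1 x y * c.β x y
        + c.p0 x y * c.bsq x y) * h2
    have e2 : c.fv x y ^ 2 * (c.p0 x y * c.Δ x y) = c.p0 x y * (c.fv x y ^ 2 * (c.es x * c.p x y)
        + c.msq x y * (c.p0 x y * c.fv x y ^ 2 - c.q x y ^ 2)) := by
      rw [ChangeData.Δ]
      linear_combination c.p0 x y * c.msq x y * h2
    rw [e1, e2, hc.fv_sq_eq hz, hc.msq_eq hz, hc.q_eq hz]
    field_simp
    ring
  field_simp
  linear_combination key

lemma sm1_relation (hz : (x, y) ∈ U) : c.pm1 x y / c.p x y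
    = c.s0 x y * (c.es x * c.pm1 x y * c.msq x y) + c.sm1 x y * (c.es x * c.p x y) := by
  have he := (c.es_pos x).ne'
  have hΔ := hc.Δ_ne_zero hp hz
  rw [hc.s0_eq hp hz, hc.sm1_eq hp hz]
  field_simp
  rw [ChangeData.Δ]
  ring

lemma sm2_relation (hz : (x, y) ∈ U) : c.pm1 x y / c.p x y
    = c.sm1 x y * (c.es x * c.p x y + c.es x * c.pm1 x y * c.β x y + c.p0 x y * c.bsq x y)
      + c.sm2 x y * c.q x y := by
  have hL := (hc.L_pos hz).ne'
  have hΔ := hc.Δ_ne_zero hp hz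
  have hF := (hc.fv_pos hz).ne'
  have hd := hc.det_eq hz
  rw [hc.sm1_eq hp hz, hc.sm2_eq hp hz]
  have h2 : c.q0 x y * c.fv x y ^ 2 = c.p0 x y * c.fv x y ^ 2 - c.q x y ^ 2 := by
    rw [hc.q0_eq hz]
    field_simp
  have key : c.fv x y ^ 2 * c.Δ x y = c.fv x y ^ 2 * (c.es x * c.p x y
      + c.es x * c.pm1 x y * c.β x y + c.p0 x y * c.bsq x y)
      - (c.es x * c.p x y * c.β x y + c.bsq x y * c.q x y) * c.q x y := by
    have e2 : c.fv x y ^ 2 * c.Δ x y = c.fv x y ^ 2 * (c.es x * c.p x y)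
        + c.msq x y * (c.p0 x y * c.fv x y ^ 2 - c.q x y ^ 2) := by
      rw [ChangeData.Δ]
      linear_combination c.msq x y * h2
    rw [e2, hc.fv_sq_eq hz, hc.msq_eq hz, hc.q_eq hz]
    field_simp
    ring
  field_simp
  linear_combination c.pm1 x y * key

lemma sm2_relation' (hz : (x, y) ∈ U) : -(c.pm1 x y * c.β x y) / (c.p x y * c.L x y ^ 2)
    = c.sm1 x y * (c.es x * c.pm1 x y * c.msq x y) + c.sm2 x y * (c.es x * c.p x y) := by
  have hL := (hc.L_pos hz).ne'
  have hΔ := hc.Δ_ne_zero hp hz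
  have hF := (hc.fv_pos hz).ne'
  rw [hc.sm1_eq hp hz, hc.sm2_eq hp hz]
  have h2 : c.q0 x y * c.fv x y ^ 2 = c.p0 x y * c.fv x y ^ 2 - c.q x y ^ 2 := by
    rw [hc.q0_eq hz]
    field_simp
  have key : -(c.β x y * (c.fv x y ^ 2 * c.Δ x y)) = c.L x y ^ 2 * c.es x * (c.pm1 x y * c.msq x y
      * c.fv x y ^ 2 - c.p x y * (c.es x * c.p x y * c.β x y + c.bsq x y * c.q x y)) := by
    have e2 : c.fv x y ^ 2 * c.Δ x y = c.fv x y ^ 2 * (c.es x * c.p x y)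
        + c.msq x y * (c.p0 x y * c.fv x y ^ 2 - c.q x y ^ 2) := by
      rw [ChangeData.Δ]
      linear_combination c.msq x y * h2
    rw [e2, hc.fv_sq_eq hz, hc.msq_eq hz, hc.q_eq hz]
    field_simp
    ring
  field_simp
  linear_combination c.pm1 x y * key

/-- The formula for the inverse of the changed metric. -/
lemma sum_metric_fv_mul_inverse (hz : (x, y) ∈ U) (w : Fin n → ℝ) (i : Fin n) :
    ∑ r, metric c.fv x y i r * (Real.exp (-c.σ x) / c.p x y * c.up x y w r
      - (c.s0 x y * c.bu r x y + c.sm1 x y * y r) * ∑ s, w s * c.bu s x y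
      - (c.sm1 x y * c.bu r x y + c.sm2 x y * y r) * ∑ s, w s * y s) = w i := by
  have hL := (hc.L_pos hz).ne'
  have he := (c.es_pos x).ne'
  set wβ := ∑ s, w s * c.bu s x y with hwβ
  set w0 := ∑ s, w s * y s with hw0
  -- Regrouped as the combination treated in `sum_metric_fv_mul_comb`, with α = 1/(e^σ p).
  have e : ∀ r, Real.exp (-c.σ x) / c.p x y * c.up x y w r
      - (c.s0 x y * c.bu r x y + c.sm1 x y * y r) * wβ
      - (c.sm1 x y * c.bu r x y + c.sm2 x y * y r) * w0
      = 1 / (c.es x * c.p x y) * c.up x y w r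
        + -(c.s0 x y * wβ + c.sm1 x y * w0) * c.bu r x y
        + -(c.sm1 x y * wβ + c.sm2 x y * w0) * y r := fun r => by
    rw [c.exp_neg_σ]
    field_simp
    ring
  rw [Finset.sum_congr rfl fun r _ => by rw [e r], hc.sum_metric_fv_mul_comb hz, ← hwβ, ← hw0]
  -- The relations say that the coefficients of (w_s b^s) b_i, (w_s y^s) b_i, (w_s b^s) y_i and (w_s
  -- y^s) y_i vanish, in this order.
  have k1 := hc.s0_relation hp hz
  have k2 := hc.sm2_relation hp hz
  have k3 := hc.sm1_relation hp hz
  have k4 := hc.sm2_relation' hp hz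
  have a1 : c.es x * c.p x y * (1 / (c.es x * c.p x y)) = 1 := by field_simp
  have a2 : c.es x * c.pm1 x y * (1 / (c.es x * c.p x y)) = c.pm1 x y / c.p x y := by field_simp
  have a3 : c.p0 x y * (1 / (c.es x * c.p x y)) = c.p0 x y / (c.es x * c.p x y) := by field_simp
  have a4 : c.es x * c.pm1 x y * (c.β x y / c.L x y ^ 2 * (1 / (c.es x * c.p x y)))
      = c.pm1 x y * c.β x y / (c.p x y * c.L x y ^ 2) := by field_simp
  linear_combination w i * a1 + w0 * c.b i x * a2 + wβ * c.b i x * a3 + wβ * c.yl i x y * a2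
    - w0 * c.yl i x y * a4 + (wβ * k1 + w0 * k2) * c.b i x + (wβ * k3 + w0 * k4) * c.yl i x y

/-- Identifies D^i as the inverse of ḡ applied to ½ X_i. The scalar relations compress the E_00
terms to ½ e^σ p E_00 (s_0 b^i + s_{-1} y^i) and simplify the σ_0 b^i term. -/
lemma D_eq (hz : (x, y) ∈ U) (i : Fin n) : c.D i x y
    = 1 / 2 * (Real.exp (-c.σ x) / c.p x y * c.up x y (fun i => c.X i x y) i
      - (c.s0 x y * c.bu i x y + c.sm1 x y * y i) * ∑ r, c.X r x y * c.bu r x y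
      - (c.sm1 x y * c.bu i x y + c.sm2 x y * y i) * ∑ r, c.X r x y * y r) := by
  have hL := (hc.L_pos hz).ne'
  have he := (c.es_pos x).ne'
  rw [hc.up_X hz, hc.sum_X_mul_bu hz, hc.sum_X_mul_coord hz, ChangeData.D, c.exp_neg_σ]
  have k1 := hc.s0_relation hp hz
  have k2 := hc.sm2_relation hp hz
  have k3 := hc.sm1_relation hp hz
  have k1' : c.p0 x y = (c.s0 x y * (c.es x * c.p x y + c.es x * c.pm1 x y * c.β x y
      + c.p0 x y * c.bsq x y) + c.sm1 x y * c.q x y) * (c.es x * c.p x y) := by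
    rw [← k1]; field_simp
  have k2' : c.pm1 x y = (c.sm1 x y * (c.es x * c.p x y + c.es x * c.pm1 x y * c.β x y
      + c.p0 x y * c.bsq x y) + c.sm2 x y * c.q x y) * c.p x y := by
    rw [← k2]; field_simp
  have k3' : c.pm1 x y = (c.s0 x y * (c.es x * c.pm1 x y * c.msq x y)
      + c.sm1 x y * (c.es x * c.p x y)) * c.p x y := by
    rw [← k3]; field_simp
  field_simp
  linear_combination -(c.E00 x y * c.bu i x y) * k1' - c.es x * c.E00 x y * y i * k2'
    - c.es x * c.L x y ^ 2 * c.σ0 x y * c.bu i x y * k3'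

theorem spray_eq (hz : (x, y) ∈ U) (i : Fin n) :
    spray c.fv i x y = spray c.L i x y + c.D i x y := by
  have h := hc.changed.metric_cancel hz (v := fun r => spray c.fv r x y - spray c.L r x y)
    (w := fun r => c.D r x y) fun i => by
      rw [hc.sum_metric_fv_mul_spray_sub hz]
      have := hc.sum_metric_fv_mul_inverse hp hz (fun i => c.X i x y) i
      rw [← this, Finset.mul_sum]
      exact Finset.sum_congr rfl fun r _ => by rw [hc.D_eq hp hz]; ring
  linear_combination congrFun h i

/-- Both sides have the same lowered components A_ij; `spray_eq` is used only at the given point, so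
p may vanish nearby. -/
theorem barthel_eq (hz : (x, y) ∈ U) (i j : Fin n) :
    barthel c.fv i j x y = barthel c.L i j x y + c.DN i j x y := by
  have hD : ∀ r, spray c.fv r x y - spray c.L r x y = c.D r x y := fun r => by
    rw [hc.spray_eq hp hz]; ring
  have hu : ∀ r, c.Au r j x y = c.up x y (fun l => c.A l j x y) r := fun r =>
    Finset.sum_congr rfl fun l _ => by
      rw [show c.gi x y l r = c.gi x y r l from hc.base.metricInv_symm hz l r]
  have h := hc.changed.metric_cancel hz (v := fun r => barthel c.fv r j x y - barthel c.L r j x y)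
    (w := fun r => c.DN r j x y) fun i => by
      rw [hc.sum_metric_fv_mul_barthel_sub hz hD]
      have := hc.sum_metric_fv_mul_inverse hp hz (fun l => c.A l j x y) i
      rw [← this]
      refine Finset.sum_congr rfl fun r _ => ?_
      rw [ChangeData.DN, hu, hc.sum_A_mul_coord hz]
      ring
  linear_combination congrFun h i

end IsLocalChange

end Inverse

section Chart

/-! ### From the manifold to a chart -/

variable {M : Type*} [TopologicalSpace M] [ChartedSpace (Coord n) M]

/-- The coordinates of the part of `T` over the chart `e`. -/
def coordSet (e : OpenPartialHomeomorph M (Coord n)) (T : Set (TangentBundle (𝓡 n) M)) :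
    Set (Coord n × Coord n) := {z | z.1 ∈ e.target ∧ coordVec e z.1 z.2 ∈ T}

lemma coordVec_smul (e : OpenPartialHomeomorph M (Coord n)) (x y : Coord n) (r : ℝ) :
    coordVec e x (r • y) = ⟨(coordVec e x y).proj, r • (coordVec e x y).snd⟩ := by
  simp only [coordVec]
  congr 1
  exact map_smul _ _ _

lemma oneFormFun_coordVec (e : OpenPartialHomeomorph M (Coord n))
    (b : ∀ m : M, TangentSpace (𝓡 n) m →L[ℝ] ℝ) (x y : Coord n) :
    oneFormFun b (coordVec e x y)
      = ∑ i, localRep e (oneFormFun b) x (EuclideanSpace.single i 1) * y i := by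
  have h := sum_coord_mul_clm ((b (e.symm x)).comp (mfderiv (𝓡 n) (𝓡 n) e.symm x)) y
  refine Eq.trans h.symm ?_
  exact Finset.sum_congr rfl fun i _ => mul_comm _ _

lemma localRep_changed (e : OpenPartialHomeomorph M (Coord n)) (f : ℝ → ℝ → ℝ) (σ : M → ℝ)
    (b : ∀ m : M, TangentSpace (𝓡 n) m →L[ℝ] ℝ) (L : TangentBundle (𝓡 n) M → ℝ) :
    localRep e (changed f σ b L) = (localData e f σ b L).fv := by
  funext x y
  change f _ (oneFormFun b (coordVec e x y)) = _
  rw [oneFormFun_coordVec]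
  rfl

variable [IsManifold (𝓡 n) ∞ M] {e : OpenPartialHomeomorph M (Coord n)}

/-- The map is the tangent map of the inverse chart, preceded by the identification of pairs (x, y)
with tangent vectors of coordinate space. -/
lemma contMDiffOn_coordVec (he : e ∈ IsManifold.maximalAtlas (𝓡 n) ∞ M) :
    ContMDiffOn 𝓘(ℝ, Coord n × Coord n) (𝓡 n).tangent ∞
      (fun z : Coord n × Coord n => (coordVec e z.1 z.2 : TangentBundle (𝓡 n) M))
      {z | z.1 ∈ e.target} := by
  have h1 : ContMDiffOn (𝓡 n).tangent (𝓡 n).tangent ∞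
      (tangentMapWithin (𝓡 n) (𝓡 n) e.symm e.target)
      (Bundle.TotalSpace.proj ⁻¹' e.target) :=
    (contMDiffOn_symm_of_mem_maximalAtlas he).contMDiffOn_tangentMapWithin (by simp)
      e.open_target.uniqueMDiffOn
  have h2 : ContMDiff 𝓘(ℝ, Coord n × Coord n) (𝓡 n).tangent ∞
      (fun z : Coord n × Coord n => (⟨z.1, z.2⟩ : TangentBundle (𝓡 n) (Coord n))) := by
    have h3 := contMDiff_tangentBundleModelSpaceHomeomorph_symm (I := 𝓡 n) (n := ∞)
    -- The identity map between the product as a normed space and as the model space of the tangent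
    -- bundle.
    have h4 : ContMDiff 𝓘(ℝ, Coord n × Coord n) (𝓡 n).tangent ∞
        (M' := ModelProd (Coord n) (Coord n)) (fun z : Coord n × Coord n => z) := by
      rw [modelWithCornersSelf_prod]
      exact contMDiff_id (I := (𝓡 n).tangent) (M := ModelProd (Coord n) (Coord n))
    exact h3.comp h4
  refine (h1.comp h2.contMDiffOn fun z hz => hz).congr fun z hz => ?_
  simp only [Function.comp_apply, tangentMapWithin, coordVec]
  rw [mfderivWithin_of_isOpen e.open_target hz]

lemma isOpen_coordSet (he : e ∈ IsManifold.maximalAtlas (𝓡 n) ∞ M)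
    {T : Set (TangentBundle (𝓡 n) M)} (hT : IsOpen T) : IsOpen (coordSet e T) :=
  (contMDiffOn_coordVec he).continuousOn.isOpen_inter_preimage
    (e.open_target.preimage continuous_fst) hT

lemma sm_localRep (he : e ∈ IsManifold.maximalAtlas (𝓡 n) ∞ M)
    {T : Set (TangentBundle (𝓡 n) M)} {L : TangentBundle (𝓡 n) M → ℝ}
    (hL : ContMDiffOn (𝓡 n).tangent 𝓘(ℝ, ℝ) ∞ L T) : Sm (coordSet e T) (localRep e L) :=
  (hL.comp ((contMDiffOn_coordVec he).mono fun _ hz => hz.1) fun _ hz => hz.2).contDiffOn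

lemma IsFinslerOn.isLocalFinsler (he : e ∈ IsManifold.maximalAtlas (𝓡 n) ∞ M)
    {T : Set (TangentBundle (𝓡 n) M)} {L : TangentBundle (𝓡 n) M → ℝ} (hL : IsFinslerOn T L) :
    IsLocalFinsler (coordSet e T) (localRep e L) where
  isOpen := isOpen_coordSet he hL.isOpen
  conic x y hz r hr := ⟨hz.1, by
    change coordVec e x (r • y) ∈ T
    rw [coordVec_smul]
    exact hL.cone _ hz.2 r hr⟩
  smooth := sm_localRep he hL.smooth
  pos x y hz := hL.pos _ hz.2
  hom x y hz r hr := by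
    rw [localRep, coordVec_smul, pow_one]
    exact hL.homogeneous _ hz.2 r hr
  nondegenerate x y hz := hL.nondegenerate e he x hz.1 y hz.2

lemma isLocalChange_localData (he : e ∈ IsManifold.maximalAtlas (𝓡 n) ∞ M)
    {T : Set (TangentBundle (𝓡 n) M)} {L : TangentBundle (𝓡 n) M → ℝ} {σ : M → ℝ}
    {b : ∀ m : M, TangentSpace (𝓡 n) m →L[ℝ] ℝ} {Ω : Set (ℝ × ℝ)} {f : ℝ → ℝ → ℝ}
    (hL : IsFinslerOn T L) (hσ : ContMDiff (𝓡 n) 𝓘(ℝ, ℝ) ∞ σ)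
    (hb : ContMDiff (𝓡 n).tangent 𝓘(ℝ, ℝ) ∞ (oneFormFun b)) (hf : IsHomogeneousOn Ω f)
    (hΩ : ∀ v ∈ T, (Real.exp (σ v.proj) * L v, oneFormFun b v) ∈ Ω)
    (hLbar : IsFinslerOn T (changed f σ b L)) :
    IsLocalChange (localData e f σ b L) (coordSet e T) Ω where
  base := hL.isLocalFinsler he
  changed := localRep_changed e f σ b L ▸ hLbar.isLocalFinsler he
  smooth_σ := by
    have h := (hσ.comp_contMDiffOn (contMDiffOn_symm_of_mem_maximalAtlas he)).contDiffOn
    exact h.comp contDiff_fst.contDiffOn fun z hz => hz.1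
  smooth_b i := by
    -- The component b_i is β evaluated at a coordinate vector, which need not lie in T; hence
    -- smoothness over the whole tangent bundle.
    have h := sm_localRep he (hb.contMDiffOn (s := Set.univ))
    exact h.comp (g := fun z : Coord n × Coord n => localRep e (oneFormFun b) z.1 z.2)
      (contDiff_fst.prodMk contDiff_const).contDiffOn
      (f := fun z : Coord n × Coord n => (z.1, EuclideanSpace.single i 1))
      fun z hz => ⟨hz.1, trivial⟩
  hom_f := hf
  mem x y hz := by
    have h := hΩ _ hz.2
    rw [oneFormFun_coordVec] at h
    exact h

end Chart

end BetaConformal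

end

/-! ### The theorem on the manifold -/

theorem mainTheorem2 {n : ℕ} {M : Type*} [TopologicalSpace M]
    [ChartedSpace (EuclideanSpace ℝ (Fin n)) M] [IsManifold (𝓡 n) ∞ M]
    (T : Set (TangentBundle (𝓡 n) M)) (L : TangentBundle (𝓡 n) M → ℝ)
    (σ : M → ℝ) (b : ∀ m : M, TangentSpace (𝓡 n) m →L[ℝ] ℝ)
    (Ω : Set (ℝ × ℝ)) (f : ℝ → ℝ → ℝ)
    (hL : BetaConformal.IsFinslerOn T L)
    (hσ : ContMDiff (𝓡 n) 𝓘(ℝ, ℝ) ∞ σ)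
    (hb : ContMDiff (𝓡 n).tangent 𝓘(ℝ, ℝ) ∞ (BetaConformal.oneFormFun b))
    (hf : BetaConformal.IsHomogeneousOn Ω f)
    (hΩ : ∀ v ∈ T, (Real.exp (σ v.proj) * L v, BetaConformal.oneFormFun b v) ∈ Ω)
    (hLbar : BetaConformal.IsFinslerOn T (BetaConformal.changed f σ b L))
    (e : OpenPartialHomeomorph M (EuclideanSpace ℝ (Fin n)))
    (he : e ∈ IsManifold.maximalAtlas (𝓡 n) ∞ M)
    (x y : EuclideanSpace ℝ (Fin n)) (hx : x ∈ e.target)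
    (hy : BetaConformal.coordVec e x y ∈ T)
    (hp : (BetaConformal.localData e f σ b L).p x y ≠ 0) :
    (∀ i : Fin n,
      BetaConformal.spray
          (BetaConformal.localRep e (BetaConformal.changed f σ b L)) i x y
        = BetaConformal.spray (BetaConformal.localRep e L) i x y
          + (BetaConformal.localData e f σ b L).D i x y) ∧
    (∀ i j : Fin n,
      BetaConformal.barthel
          (BetaConformal.localRep e (BetaConformal.changed f σ b L)) i j x y
        = BetaConformal.barthel (BetaConformal.localRep e L) i j x y
          + (BetaConformal.localData e f σ b L).DN i j x y) := by
  have hc := BetaConformal.isLocalChange_localData he hL hσ hb hf hΩ hLbar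
  rw [BetaConformal.localRep_changed]
  exact ⟨hc.spray_eq hp ⟨hx, hy⟩, hc.barthel_eq hp ⟨hx, hy⟩⟩
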